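/- All groups are finite. A \emph{Frobenius complement} is a group isomorphic to a subgroup $H$ of a finite group $G$ with $1\ne H\ne G$ and $H\cap gHg^{-1}=1$ for all $g\in G\setminus H$. A group is \emph{Sylow-cyclic} if all of its Sylow subgroups are cyclic, and its \emph{breadth} is the number of distinct primes dividing the order of its commutator subgroup. For integers $s\ge 1$ and $N\ge 0$ let $\mathcal T_s(N)$ be the number of isomorphism classes of Sylow-cyclic Frobenius complements of breadth $s$ and order at most $N$, and let $\mathcal O_s(N)$ be the number of those of odd order. Write $[t_1,\dots,t_s]$ for the least common multiple, $t_0$ for the product of the distinct primes dividing $t$, and $\phi$ for Euler's function. For $t>1$ let $\mathcal U_N(t)$ be the set of $s$-tuples $\tau=((p_1^{a_1},t_1),\dots,(p_s^{a_s},t_s))$, with $p_i$ prime and $a_i,t_i$ positive integers, such that $[t_1,\dots,t_s]=t$ and, for all $i,j\le s$, (1) $t_i>1$ and $p_i\equiv 1\pmod{t_i}$; (2) $p_j\nmid t_i$, and $p_i\ne p_j$ if $i\ne j$; (3) $p_1^{a_1}\cdots p_s^{a_s}\,t\,t_0\le N$. For $\tau\in\mathcal U_N(t)$ set $\phi(\tau)=\frac{1}{\phi(t)}\prod_{i=1}^s\phi(t_i)$,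 and let $K(\tau)$ be the set of positive integers $k$ with $p_j\nmid k$ for all $j\le s$ and $p_1^{a_1}\cdots p_s^{a_s}\,t\,t_0\,k\le N$. Then for all integers $s\ge1$ and $N\ge 0$, $$s!\,\mathcal T_s(N)=\sum_{2\le t\le\sqrt N}\ \sum_{\tau\in\mathcal U_N(t)}|K(\tau)|\,\phi(\tau)$$ and $$s!\,\mathcal O_s(N)=\sum_{\substack{2\le t\le\sqrt N\\ 2\nmid t}}\ \sum_{\tau\in\mathcal U_N(t)}|\{k\in K(\tau):2\nmid k\}|\,\phi(\tau).$$ -/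

import Mathlib

/-! ### Sylow-cyclic Frobenius complements and their isomorphism classes -/

/-- A subgroup `H` of a group `G` is a Frobenius complement in `G` if it is nontrivial, proper,
and `H ∩ gHg⁻¹ = 1` for every `g ∈ G \ H`. -/
def Subgroup.IsFrobeniusComplementIn {G : Type} [Group G] (H : Subgroup G) : Prop :=
  H ≠ ⊥ ∧ H ≠ ⊤ ∧ ∀ g : G, g ∉ H → H ⊓ H.map (MulAut.conj g).toMonoidHom = ⊥

/-- A group is a Frobenius complement if it is isomorphic to a Frobenius complement in some
finite group. -/
def IsFrobeniusComplement (H : Type) [Group H] : Prop :=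
  ∃ (G : Type) (_ : Group G) (L : Subgroup G),
    Finite G ∧ L.IsFrobeniusComplementIn ∧ Nonempty (H ≃* L)

/-- The number of distinct primes dividing the order of the commutator subgroup. -/
noncomputable def breadth (H : Type) [Group H] : ℕ :=
  (Nat.card (commutator H)).primeFactors.card

/-- Isomorphism of groups. -/
def groupIsoSetoid : Setoid GrpCat.{0} where
  r G H := Nonempty (G ≃* H)
  iseqv := ⟨fun G => ⟨MulEquiv.refl G⟩, fun ⟨e⟩ => ⟨e.symm⟩, fun ⟨e⟩ ⟨f⟩ => ⟨e.trans f⟩⟩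

/-- The isomorphism classes of finite groups of order at most `N` that are Frobenius complements,
have only cyclic Sylow subgroups, and have breadth `s`. Every finite group is isomorphic to one
whose underlying set lies in the lowest universe, so no class is lost. -/
def complementClasses (s N : ℕ) : Set (Quotient groupIsoSetoid) :=
  Quotient.mk groupIsoSetoid ''
    {H | Finite H ∧ IsZGroup H ∧ IsFrobeniusComplement H ∧ breadth H = s ∧ Nat.card H ≤ N}

/-- The isomorphism classes as in `complementClasses` of groups of odd order. -/
def oddComplementClasses (s N : ℕ) : Set (Quotient groupIsoSetoid) :=
  Quotient.mk groupIsoSetoid ''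
    {H | Finite H ∧ IsZGroup H ∧ IsFrobeniusComplement H ∧ breadth H = s ∧ Nat.card H ≤ N ∧
      Odd (Nat.card H)}

/-- The number `T_s(N)` of isomorphism classes of Sylow-cyclic Frobenius complements of
breadth `s` and order at most `N`. -/
noncomputable def numComplements (s N : ℕ) : ℕ := (complementClasses s N).ncard

/-- The number `O_s(N)` of isomorphism classes of Sylow-cyclic Frobenius complements of
breadth `s`, odd order, and order at most `N`. -/
noncomputable def numOddComplements (s N : ℕ) : ℕ := (oddComplementClasses s N).ncard

/-- The set that is counted by `numComplements` is finite. -/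
theorem complementClasses_finite (s N : ℕ) : (complementClasses s N).Finite := by
  classical
  have hfin : ∀ n : ℕ, Finite (Group (Fin n)) := fun n =>
    Finite.of_injective (fun (g : Group (Fin n)) (a b : Fin n) => g.mul a b) (by
      intro g h hgh
      refine Group.ext (funext fun a => funext fun b => ?_)
      exact congrFun (congrFun hgh _) _)
  let F : (Σ n : Fin (N + 1), Group (Fin n)) → Quotient groupIsoSetoid :=
    fun x => Quotient.mk groupIsoSetoid (@GrpCat.of (Fin x.1) x.2)
  have : Finite (Σ n : Fin (N + 1), Group (Fin n)) := inferInstance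
  refine (Set.finite_range F).subset ?_
  rintro _ ⟨H, ⟨hH, -, -, -, hc⟩, rfl⟩
  have e : H ≃ Fin (Nat.card H) := Finite.equivFin H
  refine ⟨⟨⟨Nat.card H, Nat.lt_succ_of_le hc⟩, e.symm.group⟩, ?_⟩
  apply Quotient.sound
  exact ⟨@Equiv.mulEquiv _ _ e.symm _⟩

/-- The set that is counted by `numOddComplements` is finite. -/
theorem oddComplementClasses_finite (s N : ℕ) : (oddComplementClasses s N).Finite := by
  refine (complementClasses_finite s N).subset (Set.image_mono ?_)
  rintro H ⟨h1, h2, h3, h4, h5, -⟩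
  exact ⟨h1, h2, h3, h4, h5⟩

/-! ### The arithmetic side -/

/-- `t₀`, the product of the distinct primes dividing `t`. -/
def radical₀ (t : ℕ) : ℕ := ∏ p ∈ t.primeFactors, p

namespace CountTuple

variable {s : ℕ}

/-- For `τ = ((p₁^a₁, t₁), …, (pₛ^aₛ, tₛ))`, the prime power `pᵢ^aᵢ`. -/
def q (τ : Fin s → ℕ × ℕ) (i : Fin s) : ℕ := (τ i).1

/-- The prime `pᵢ` of which `pᵢ^aᵢ` is a power. -/
def p (τ : Fin s → ℕ × ℕ) (i : Fin s) : ℕ := (q τ i).minFac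

/-- The integer `tᵢ`. -/
def t (τ : Fin s → ℕ × ℕ) (i : Fin s) : ℕ := (τ i).2

/-- The least common multiple `[t₁, …, tₛ]`. -/
def lcm (τ : Fin s → ℕ × ℕ) : ℕ := Finset.univ.lcm (t τ)

/-- The product `p₁^a₁ ⋯ pₛ^aₛ`. -/
def m (τ : Fin s → ℕ × ℕ) : ℕ := ∏ i, q τ i

/-- `τ` has the shape `((p₁^a₁, t₁), …, (pₛ^aₛ, tₛ))` with `pᵢ` prime, `aᵢ ≥ 1`, `tᵢ ≥ 1`. -/
def IsTuple (τ : Fin s → ℕ × ℕ) : Prop := ∀ i, IsPrimePow (q τ i) ∧ 0 < t τ i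

/-- Condition (1): `tᵢ > 1` and `pᵢ ≡ 1 (mod tᵢ)`. -/
def Cond1 (τ : Fin s → ℕ × ℕ) : Prop := ∀ i, 1 < t τ i ∧ p τ i ≡ 1 [MOD t τ i]

/-- Condition (2): `pⱼ ∤ tᵢ`, and `pᵢ ≠ pⱼ` if `i ≠ j`. -/
def Cond2 (τ : Fin s → ℕ × ℕ) : Prop :=
  ∀ i j, ¬ p τ j ∣ t τ i ∧ (i ≠ j → p τ i ≠ p τ j)

/-- Condition (3): `p₁^a₁ ⋯ pₛ^aₛ [t₁, …, tₛ] [t₁, …, tₛ]₀ ≤ N`. -/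
def Cond3 (N : ℕ) (τ : Fin s → ℕ × ℕ) : Prop := m τ * lcm τ * radical₀ (lcm τ) ≤ N

/-- Condition (4): `pⱼ ∤ k` and `p₁^a₁ ⋯ pₛ^aₛ [t₁, …, tₛ] [t₁, …, tₛ]₀ k ≤ N`. -/
def Cond4 (N k : ℕ) (τ : Fin s → ℕ × ℕ) : Prop :=
  (∀ j, ¬ p τ j ∣ k) ∧ m τ * lcm τ * radical₀ (lcm τ) * k ≤ N

/-- `φ(τ) = (∏ φ(tᵢ)) / φ([t₁, …, tₛ])`, as a rational number. -/
def phi (τ : Fin s → ℕ × ℕ) : ℚ :=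
  (∏ i, (Nat.totient (t τ i) : ℚ)) / (Nat.totient (lcm τ) : ℚ)

end CountTuple

open CountTuple in
/-- The set `U_N(t)` of the `s`-tuples `τ` with `[t₁, …, tₛ] = t` that satisfy conditions
(1), (2) and (3). -/
def tupleSet (s N t : ℕ) : Set (Fin s → ℕ × ℕ) :=
  {τ | IsTuple τ ∧ lcm τ = t ∧ Cond1 τ ∧ Cond2 τ ∧ Cond3 N τ}

open CountTuple in
/-- The set `K(τ)` of the integers `k ≥ 1` such that `(k, τ)` satisfies conditions (1)-(4). -/
def multiplierSet {s : ℕ} (N : ℕ) (τ : Fin s → ℕ × ℕ) : Set ℕ :=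
  {k | 0 < k ∧ IsTuple τ ∧ Cond1 τ ∧ Cond2 τ ∧ Cond3 N τ ∧ Cond4 N k τ}

theorem radical₀_pos (t : ℕ) : 0 < radical₀ t :=
  Finset.prod_pos fun _ h => (Nat.prime_of_mem_primeFactors h).pos

open CountTuple in
theorem CountTuple.lcm_pos {s : ℕ} {τ : Fin s → ℕ × ℕ} (h : IsTuple τ) : 0 < lcm τ := by
  apply Nat.pos_of_ne_zero
  unfold lcm
  rw [Ne, Finset.lcm_eq_zero_iff]
  rintro ⟨i, -, hi⟩
  exact (h i).2.ne' hi

/-- The sets `U_N(t)` are finite. -/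
theorem tupleSet_finite (s N t : ℕ) : (tupleSet s N t).Finite := by
  refine (Set.Finite.pi' (t := fun _ : Fin s => Set.Iic N ×ˢ Set.Iic N)
    fun _ => (Set.finite_Iic N).prod (Set.finite_Iic N)).subset ?_
  rintro τ ⟨h, -, -, -, h3⟩ i
  have hl := CountTuple.lcm_pos h
  have hr := radical₀_pos (CountTuple.lcm τ)
  have hm : 0 < CountTuple.m τ := Finset.prod_pos fun j _ => (h j).1.pos
  have hq : CountTuple.q τ i ≤ CountTuple.m τ :=
    Nat.le_of_dvd hm (Finset.dvd_prod_of_mem _ (Finset.mem_univ i))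
  have ht : CountTuple.t τ i ≤ CountTuple.lcm τ :=
    Nat.le_of_dvd hl (Finset.dvd_lcm (Finset.mem_univ i))
  have h3' : CountTuple.m τ * CountTuple.lcm τ ≤ N := (Nat.le_mul_of_pos_right _ hr).trans h3
  exact ⟨hq.trans ((Nat.le_mul_of_pos_right _ hl).trans h3'),
    ht.trans ((Nat.le_mul_of_pos_left _ hm).trans h3')⟩

/-- The sets `K(τ)` are finite. -/
theorem multiplierSet_finite {s : ℕ} (N : ℕ) (τ : Fin s → ℕ × ℕ) :
    (multiplierSet N τ).Finite := by
  refine (Set.finite_Iic N).subset ?_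
  rintro k ⟨-, h, -, -, -, -, h4⟩
  have hl := CountTuple.lcm_pos h
  have hr := radical₀_pos (CountTuple.lcm τ)
  have hm : 0 < CountTuple.m τ := Finset.prod_pos fun j _ => (h j).1.pos
  exact (Nat.le_mul_of_pos_left k (by positivity)).trans h4

/-- `U_N(t)` as a finite set, to sum over. -/
noncomputable def tupleFinset (s N t : ℕ) : Finset (Fin s → ℕ × ℕ) :=
  (tupleSet_finite s N t).toFinset

/-! In a Sylow-cyclic group `H` the commutator subgroup is cyclic, of order `m` prime to its index
`n`. A generator `y` of `H` modulo it acts on it as an `r`-th power with `r - 1` a unit modulo `m`.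
Hence `y` has order `n`, `H` is a semidirect product of `C_m` by `C_n`, and its class is determined
by `m`, `n` and the subgroup generated by `r` in the units modulo `m`.

For `m > 1`, with `t` the order of `r` modulo `m`, such a group is a Frobenius complement if and
only if `t t₀ ∣ n`. Both directions use fixed-point-free actions on abelian groups. For necessity, a
solvable complement acquires a normal complement by transfer; Frattini's argument and
Schur–Zassenhaus make it act on the centre of a Sylow subgroup of that kernel. Under such an action
elements of prime order centralize abelian normal subgroups
(`HasFixedPointFreeAction.commute_of_prime_order`). For sufficiency, a faithful character of the
cyclic centralizer of the commutator subgroup is induced to the whole group.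

The formula is a double count of classes against pairs `(τ, k)`, where `m = ∏ pᵢ^aᵢ`, `n = t t₀ k`
and `tᵢ` is the order of `r` modulo `pᵢ^aᵢ`. A class of breadth `s` belongs to `s!` pairs, one for
each ordering of the primes dividing `m` (`ncard_realized_pairs`). A pair belongs to `φ(τ)` classes
(`IsValidPair.ncard_realizedClasses`): there are `∏ φ(tᵢ)` residues `r`, and `φ(t)` of them generate
any given cyclic subgroup that occurs. -/

/-! ### Fixed-point-free actions on abelian groups -/

/-- `H` acts by automorphisms on a nontrivial finite abelian group in such a way that no nontrivial
element of `H` has a nontrivial fixed point. -/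
def HasFixedPointFreeAction (H : Type) [Group H] : Prop :=
  ∃ (V : Type) (_ : CommGroup V) (ρ : H →* MulAut V), Finite V ∧ Nontrivial V ∧
    ∀ h : H, h ≠ 1 → ∀ v : V, ρ h v = v → v = 1

/-- In `V ⋊ H`, let `g` lie outside `H`, so that its `V`-component `v` is nontrivial. If `h = g k
g⁻¹` with `h` and `k` in `H`, comparing `V`-components shows that `h` fixes `v`. -/
theorem HasFixedPointFreeAction.isFrobeniusComplement {H : Type} [Group H] [Finite H]
    [Nontrivial H] (hH : HasFixedPointFreeAction H) : IsFrobeniusComplement H := by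
  obtain ⟨V, _, ρ, hV, hV1, hfix⟩ := hH
  refine ⟨V ⋊[ρ] H, inferInstance, (SemidirectProduct.inr : H →* V ⋊[ρ] H).range,
    Finite.of_equiv _ SemidirectProduct.equivProd.symm, ⟨?_, ?_, ?_⟩,
    ⟨MonoidHom.ofInjective SemidirectProduct.inr_injective⟩⟩
  · obtain ⟨h, hh⟩ := exists_ne (1 : H)
    intro hbot
    have : (SemidirectProduct.inr h : V ⋊[ρ] H) ∈ (⊥ : Subgroup (V ⋊[ρ] H)) :=
      hbot ▸ ⟨h, rfl⟩
    rw [Subgroup.mem_bot] at this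
    exact hh (SemidirectProduct.inr_injective (this.trans (map_one _).symm))
  · obtain ⟨v, hv⟩ := exists_ne (1 : V)
    intro htop
    have : (SemidirectProduct.inl v : V ⋊[ρ] H) ∈ (SemidirectProduct.inr : H →* V ⋊[ρ] H).range :=
      htop ▸ Subgroup.mem_top _
    obtain ⟨h, hh⟩ := this
    exact hv (by simpa using (congrArg SemidirectProduct.left hh).symm)
  · intro g hg
    rw [eq_bot_iff]
    rintro x ⟨⟨h, rfl⟩, ⟨y, ⟨k, rfl⟩, hy⟩⟩
    have hgl : g.left ≠ 1 := by
      intro h1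
      refine hg ⟨g.right, ?_⟩
      ext <;> simp [h1]
    have e1 := congrArg SemidirectProduct.left hy
    have e2 := congrArg SemidirectProduct.right hy
    simp only [MulEquiv.toMonoidHom_eq_coe, MonoidHom.coe_coe, MulAut.conj_apply,
      SemidirectProduct.mul_left, SemidirectProduct.mul_right, SemidirectProduct.inv_left,
      SemidirectProduct.left_inr, SemidirectProduct.right_inr, SemidirectProduct.inv_right,
      map_one, mul_one] at e1 e2
    have e3 : ρ h g.left = g.left := by
      rw [← MulAut.mul_apply, ← map_mul, e2, map_inv, mul_inv_eq_one] at e1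
      exact e1.symm
    rw [Subgroup.mem_bot]
    by_contra hne
    exact hgl (hfix h (fun h1 => hne (by rw [h1, map_one])) _ e3)

/-- Dirichlet's theorem provides a prime `l` congruent to `1` modulo the order of `A`; the cyclic
group of units modulo `l` then has an element of that order. -/
theorem exists_injective_hom_units_zmod (A : Type) [Group A] [Finite A] [IsCyclic A] :
    ∃ (l : ℕ) (_ : Fact l.Prime) (χ : A →* (ZMod l)ˣ), Function.Injective χ := by
  obtain ⟨l, hl, -, hmod⟩ := Nat.exists_prime_gt_modEq_one 0 (Nat.card_pos (α := A)).ne'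
  have : Fact l.Prime := ⟨hl⟩
  obtain ⟨a, ha⟩ := IsCyclic.exists_generator (α := A)
  obtain ⟨z, hz⟩ := IsCyclic.exists_ofOrder_eq_natCard (α := (ZMod l)ˣ)
  have hdvd : Nat.card A ∣ l - 1 := (Nat.modEq_iff_dvd' hl.one_lt.le).1 hmod.symm
  have hcard : Nat.card (ZMod l)ˣ = l - 1 := by
    rw [Nat.card_eq_fintype_card, ZMod.card_units]
  have hl1 : 0 < l - 1 := Nat.sub_pos_of_lt hl.one_lt
  obtain ⟨d, hd⟩ := hdvd
  have hd0 : d ≠ 0 := by rintro rfl; omega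
  have hord : orderOf (z ^ d) = Nat.card A := by
    rw [orderOf_pow_of_dvd hd0 (by rw [hz, hcard, hd]; exact dvd_mul_left _ _), hz, hcard, hd,
      Nat.mul_div_cancel _ (Nat.pos_of_ne_zero hd0)]
  have hoa : orderOf a = Nat.card A := orderOf_eq_card_of_forall_mem_zpowers ha
  refine ⟨l, inferInstance, monoidHomOfForallMemZpowers ha (g' := z ^ d)
    (by rw [hord, hoa]), ?_⟩
  rw [injective_iff_map_eq_one]
  intro x hx
  obtain ⟨k, rfl⟩ := ha x
  rw [map_zpow, monoidHomOfForallMemZpowers_apply_gen, ← orderOf_dvd_iff_zpow_eq_one, hord,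
    ← hoa, orderOf_dvd_iff_zpow_eq_one] at hx
  exact hx

/-- The module induced from a character `χ` of a subgroup `A`. -/
def inducedModule {H F : Type} [Group H] [CommRing F] (A : Subgroup H) (χ : A →* Fˣ) :
    AddSubgroup (H → F) where
  carrier := {f | ∀ (a : A) (h : H), f (a * h) = χ a * f h}
  zero_mem' := fun a h => by simp
  add_mem' := fun {f g} hf hg a h => by
    simp only [Pi.add_apply, hf a h, hg a h, mul_add]
  neg_mem' := fun {f} hf a h => by
    simp only [Pi.neg_apply, hf a h, mul_neg]

/-- `H` acts on `inducedModule` by right translation. -/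
def inducedAction {H F : Type} [Group H] [CommRing F] (A : Subgroup H) (χ : A →* Fˣ) :
    H →* MulAut (Multiplicative (inducedModule A χ)) where
  toFun g :=
    { toFun := fun f => Multiplicative.ofAdd ⟨fun h => f.toAdd.1 (h * g), fun a h => by
        simpa only [mul_assoc] using f.toAdd.2 a _⟩
      invFun := fun f => Multiplicative.ofAdd ⟨fun h => f.toAdd.1 (h * g⁻¹), fun a h => by
        simpa only [mul_assoc] using f.toAdd.2 a _⟩
      left_inv := fun f => by
        apply Multiplicative.toAdd.injective
        apply Subtype.ext
        funext h
        simp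
      right_inv := fun f => by
        apply Multiplicative.toAdd.injective
        apply Subtype.ext
        funext h
        simp
      map_mul' := fun f g => rfl }
  map_one' := by
    refine MulEquiv.ext fun f => ?_
    apply Multiplicative.toAdd.injective
    apply Subtype.ext
    funext h
    simp
  map_mul' a b := by
    refine MulEquiv.ext fun f => ?_
    apply Multiplicative.toAdd.injective
    apply Subtype.ext
    funext h
    simp [mul_assoc]

/-- If a cyclic normal subgroup contains all elements of prime order, then inducing a faithful
character from it gives a fixed-point-free action. -/
theorem hasFixedPointFreeAction_of_isCyclic {H : Type} [Group H] [Finite H] (A : Subgroup H)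
    [A.Normal] [IsCyclic A] (hA : ∀ h : H, (orderOf h).Prime → h ∈ A) :
    HasFixedPointFreeAction H := by
  classical
  obtain ⟨l, _, χ, hχ⟩ := exists_injective_hom_units_zmod A
  refine ⟨Multiplicative (inducedModule A χ), inferInstance, inducedAction A χ, ?_, ?_, ?_⟩
  · exact inferInstanceAs (Finite (inducedModule A χ))
  -- Extending the character by zero outside `A` gives an element with value `1` at the identity, so
  -- the module is nontrivial.
  · have hmem : (fun h : H => if hh : h ∈ A then ((χ ⟨h, hh⟩ : (ZMod l)ˣ) : ZMod l) else 0) ∈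
        inducedModule A χ := by
      intro a h
      by_cases hh : h ∈ A
      · have h2 : (a : H) * h ∈ A := A.mul_mem a.2 hh
        have h3 : (⟨(a : H) * h, h2⟩ : A) = a * ⟨h, hh⟩ := rfl
        simp only [hh, h2, dite_true, h3, map_mul, Units.val_mul]
      · have h2 : (a : H) * h ∉ A := fun h3 => hh ((A.mul_mem_cancel_left a.2).1 h3)
        simp [hh, h2]
    refine ⟨⟨Multiplicative.ofAdd ⟨_, hmem⟩, 1, fun heq => ?_⟩⟩
    have := congrFun (congrArg Subtype.val (congrArg Multiplicative.toAdd heq)) 1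
    simp [A.one_mem] at this
  -- A function fixed by `g` is fixed by a power `g ^ k` of prime order, which lies in `A`. Then `f
  -- h = χ (h g ^ k h⁻¹) * f h` with a character value different from `1`, so `f h = 0`.
  · intro g hg f hf
    have hord : orderOf g ≠ 1 := fun h => hg (orderOf_eq_one_iff.1 h)
    obtain ⟨q, hq, k, hk⟩ := Nat.exists_prime_and_dvd hord
    have hpos := orderOf_pos g
    have hk0 : k ≠ 0 := by rintro rfl; omega
    have hgk : orderOf (g ^ k) = q := by
      rw [orderOf_pow_of_dvd hk0 ⟨q, by rw [hk, mul_comm]⟩, hk,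
        Nat.mul_div_cancel _ (Nat.pos_of_ne_zero hk0)]
    have hfk : inducedAction A χ (g ^ k) f = f := by
      rw [map_pow]
      clear hgk hk0 hk
      induction k with
      | zero => simp
      | succ k ih => rw [pow_succ, MulAut.mul_apply, hf, ih]
    have hmem : g ^ k ∈ A := hA _ (hgk ▸ hq)
    have hne : g ^ k ≠ 1 := fun h => hq.one_lt.ne' (by rw [← hgk, h, orderOf_one])
    apply Multiplicative.toAdd.injective
    apply Subtype.ext
    funext h
    have e1 : f.toAdd.1 (h * g ^ k) = f.toAdd.1 h :=
      congrFun (congrArg Subtype.val (congrArg Multiplicative.toAdd hfk)) h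
    let a : A := ⟨h * g ^ k * h⁻¹, ‹A.Normal›.conj_mem _ hmem h⟩
    have e2 : h * g ^ k = a * h := by simp [a]
    have ha : a ≠ 1 := by
      intro h1
      have := congrArg Subtype.val h1
      simp only [a, Subgroup.coe_one, conj_eq_one_iff] at this
      exact hne this
    rw [e2, f.toAdd.2 a h] at e1
    have hχa : ((χ a : (ZMod l)ˣ) : ZMod l) ≠ 1 := fun h1 =>
      ha (hχ (by rw [map_one]; exact Units.ext h1))
    have e3 : (((χ a : (ZMod l)ˣ) : ZMod l) - 1) * f.toAdd.1 h = 0 := by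
      rw [sub_mul, e1, one_mul, sub_self]
    exact (mul_eq_zero.1 e3).resolve_left (sub_ne_zero.2 hχa)

/-- Translation by `c` permutes the factors, so the product is fixed by the nontrivial element `ψ
c`. -/
theorem prod_action_eq_one {H V C : Type} [Group H] [CommGroup V] [Group C] [Fintype C]
    {ρ : H →* MulAut V} (hfix : ∀ h : H, h ≠ 1 → ∀ v : V, ρ h v = v → v = 1) (ψ : C →* H)
    {c : C} (hc : ψ c ≠ 1) (v : V) : ∏ d : C, ρ (ψ d) v = 1 := by
  refine hfix _ hc _ ?_
  rw [map_prod]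
  refine Fintype.prod_equiv (Equiv.mulLeft c) _ _ fun d => ?_
  simp

theorem prod_range_action_eq_one {H V : Type} [Group H] [CommGroup V]
    {ρ : H →* MulAut V} (hfix : ∀ h : H, h ≠ 1 → ∀ v : V, ρ h v = v → v = 1) {u : H} (hu : u ≠ 1)
    {n : ℕ} (hn : u ^ n = 1) (v : V) : ∏ j ∈ Finset.range n, ρ (u ^ j) v = 1 := by
  refine hfix _ hu _ ?_
  rw [map_prod]
  have h1 : ∀ j, ρ u (ρ (u ^ j) v) = ρ (u ^ (j + 1)) v := fun j => by
    rw [pow_succ', map_mul, MulAut.mul_apply]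
  simp only [h1]
  have h2 := Finset.prod_range_succ (fun j => ρ (u ^ j) v) n
  rw [Finset.prod_range_succ', hn, pow_zero] at h2
  exact mul_right_cancel h2

/-- The homomorphism `d ↦ [d, w]` on an abelian normal subgroup. -/
def commutatorHom {H : Type} [Group H] (C : Subgroup H) [hC : C.Normal]
    (hcomm : ∀ a ∈ C, ∀ b ∈ C, a * b = b * a) (w : H) : C →* H :=
  MonoidHom.mk' (fun d => d * (w * (d : H)⁻¹ * w⁻¹)) (by
    intro a b
    have hb : w * (b : H)⁻¹ * w⁻¹ ∈ C := hC.conj_mem _ (C.inv_mem b.2) w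
    have ha : w * (a : H)⁻¹ * w⁻¹ ∈ C := hC.conj_mem _ (C.inv_mem a.2) w
    have h1 := hcomm _ hb _ ha
    have h2 := hcomm _ ha b b.2
    calc ((a * b : C) : H) * (w * ((a * b : C) : H)⁻¹ * w⁻¹)
        = a * b * ((w * (b : H)⁻¹ * w⁻¹) * (w * (a : H)⁻¹ * w⁻¹)) := by
          simp [mul_assoc]
      _ = a * (b * (w * (a : H)⁻¹ * w⁻¹)) * (w * (b : H)⁻¹ * w⁻¹) := by
          rw [h1]; simp only [mul_assoc]
      _ = _ := by rw [← h2]; simp only [mul_assoc])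

/-- Elements of prime order of a group with a fixed-point-free action centralize every abelian
normal subgroup. -/
theorem HasFixedPointFreeAction.commute_of_prime_order {H : Type} [Group H] [Finite H]
    (hH : HasFixedPointFreeAction H) (C : Subgroup H) [hC : C.Normal]
    (hcomm : ∀ a ∈ C, ∀ b ∈ C, a * b = b * a) {u : H} (hu : (orderOf u).Prime) :
    ∀ c ∈ C, u * c = c * u := by
  classical
  obtain ⟨V, _, ρ, hV, hV1, hfix⟩ := hH
  have := Fintype.ofFinite C
  by_contra! hcon
  obtain ⟨c, hc, hcu⟩ := hcon
  have hu1 : u ≠ 1 := fun h => hu.one_lt.ne' (by rw [h, orderOf_one])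
  -- The images of `v` under `d u ^ j d⁻¹` are multiplied over all `d` in `C` and all `j` below the
  -- order of `u`. For fixed `d` the product is `1`. For fixed `j ≠ 0` it is `1` too, because `d ↦
  -- [d, u ^ j]` is a nontrivial homomorphism. What remains is `j = 0`, which contributes `v ^ |C|`.
  have key : ∀ v : V, v ^ Fintype.card C = 1 := by
    intro v
    have h1 : ∀ d : C, ∏ j ∈ Finset.range (orderOf u), ρ (d * u ^ j * (d : H)⁻¹) v = 1 := by
      intro d
      have hne : (d : H) * u * (d : H)⁻¹ ≠ 1 := fun h => hu1 (conj_eq_one_iff.1 h)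
      have := prod_range_action_eq_one hfix hne (n := orderOf u)
        (by rw [conj_pow, pow_orderOf_eq_one]; simp) v
      simpa only [conj_pow] using this
    have h2 : ∏ j ∈ Finset.range (orderOf u), ∏ d : C, ρ (d * u ^ j * (d : H)⁻¹) v = 1 := by
      rw [Finset.prod_comm]
      exact Finset.prod_eq_one fun d _ => h1 d
    rw [Finset.prod_eq_single 0] at h2
    · simpa using h2
    · intro j hj hj0
      have hcop : Nat.Coprime (orderOf u) j :=
        (hu.coprime_iff_not_dvd).2 (fun h => absurd (Nat.le_of_dvd (Nat.pos_of_ne_zero hj0) h)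
          (not_le.2 (Finset.mem_range.1 hj)))
      have h3 : ∀ d : C, ρ (d * u ^ j * (d : H)⁻¹) v =
          ρ (commutatorHom C hcomm (u ^ j) d) (ρ (u ^ j) v) := by
        intro d
        rw [← MulAut.mul_apply, ← map_mul]
        congr 2
        simp [commutatorHom, mul_assoc]
      simp only [h3]
      refine prod_action_eq_one hfix _ (c := ⟨c, hc⟩) ?_ _
      intro h4
      have h5 : Commute (u ^ j) c := by
        have h6 : c * (u ^ j * c⁻¹ * (u ^ j)⁻¹) = 1 := h4
        have h7 : c = u ^ j * c * (u ^ j)⁻¹ := by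
          simpa [mul_assoc] using eq_inv_of_mul_eq_one_left h6
        exact (eq_mul_inv_iff_mul_eq.1 h7).symm
      -- Since `j` is prime to the order of `u`, `u` is a power of `u ^ j` and would commute with
      -- `c` as well.
      obtain ⟨k, hk⟩ := exists_pow_eq_self_of_coprime hcop.symm
      have h6 := h5.pow_left k
      rw [hk] at h6
      exact hcu h6
    · intro h
      exact absurd (Finset.mem_range.2 hu.pos) h
  -- A prime dividing `|V|` now divides `|C|`. An element of order `p` in `C` permutes `V`, whose
  -- size is divisible by `p`, so it fixes a point other than `1`.
  obtain ⟨p, hp, hpV⟩ := Nat.exists_prime_and_dvd (Finite.one_lt_card (α := V)).ne'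
  have : Fact p.Prime := ⟨hp⟩
  obtain ⟨v, hv⟩ := exists_prime_orderOf_dvd_card' p hpV
  have hpC : p ∣ Nat.card C := by
    rw [← hv, Nat.card_eq_fintype_card]
    exact orderOf_dvd_of_pow_eq_one (key v)
  obtain ⟨d, hd⟩ := exists_prime_orderOf_dvd_card' p hpC
  let _ : MulAction (Subgroup.zpowers d) V :=
    MulAction.compHom V (ρ.comp (C.subtype.comp (Subgroup.zpowers d).subtype))
  have hP : IsPGroup p (Subgroup.zpowers d) := IsPGroup.of_card (n := 1) (by
    rw [Nat.card_zpowers, hd, pow_one])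
  obtain ⟨w, hw, hw1⟩ := hP.exists_fixed_point_of_prime_dvd_card_of_fixed_point V hpV (a := 1)
    (fun g => map_one (ρ g))
  have hd1 : (d : H) ≠ 1 := by
    intro h
    have : d = 1 := Subtype.ext h
    rw [this, orderOf_one] at hd
    exact hp.one_lt.ne hd
  exact hw1 (hfix d hd1 w (hw ⟨d, Subgroup.mem_zpowers d⟩)).symm

/-! ### Frobenius complements -/

/-- `L` meets its conjugates by elements outside of `L` trivially. -/
def Subgroup.IsMalnormal {G : Type} [Group G] (L : Subgroup G) : Prop :=
  ∀ g ∉ L, ∀ h ∈ L, g * h * g⁻¹ ∈ L → h = 1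

theorem Subgroup.IsFrobeniusComplementIn.isMalnormal {G : Type} [Group G] {L : Subgroup G}
    (hL : L.IsFrobeniusComplementIn) : L.IsMalnormal := by
  intro g hg h hh hconj
  have : g * h * g⁻¹ ∈ L ⊓ L.map (MulAut.conj g).toMonoidHom := ⟨hconj, h, hh, rfl⟩
  rw [hL.2.2 g hg, Subgroup.mem_bot] at this
  exact conj_eq_one_iff.1 this

theorem Subgroup.IsMalnormal.subgroupOf {G : Type} [Group G] {L : Subgroup G}
    (hL : L.IsMalnormal) (K : Subgroup G) : (L.subgroupOf K).IsMalnormal := by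
  intro g hg h hh hconj
  exact Subtype.ext (hL g hg h hh hconj)

/-- An element `d` of prime order `p` in `L` fixes the trivial coset of `L`. If `p` divided the
index it would fix a second coset `gL`, and then `g⁻¹ d g` would lie in `L`. -/
theorem Subgroup.IsMalnormal.coprime {G : Type} [Group G] [Finite G] {L : Subgroup G}
    (hL : L.IsMalnormal) : (Nat.card L).Coprime L.index := by
  by_contra hcop
  obtain ⟨p, hp, hpL, hpi⟩ := Nat.Prime.not_coprime_iff_dvd.1 hcop
  have : Fact p.Prime := ⟨hp⟩
  obtain ⟨d, hd⟩ := exists_prime_orderOf_dvd_card' p hpL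
  have hP : IsPGroup p (Subgroup.zpowers (d : G)) := IsPGroup.of_card (n := 1) (by
    rw [Nat.card_zpowers, Subgroup.orderOf_coe, hd, pow_one])
  obtain ⟨w, hw, hw1⟩ := hP.exists_fixed_point_of_prime_dvd_card_of_fixed_point (G ⧸ L)
    hpi (a := ((1 : G) : G ⧸ L)) (by
      rintro ⟨g, hg⟩
      have hg' : g ∈ L := (Subgroup.zpowers_le.2 d.2) hg
      change ((g * 1 : G) : G ⧸ L) = _
      rw [QuotientGroup.eq]
      simpa using hg')
  obtain ⟨g, rfl⟩ := QuotientGroup.mk_surjective w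
  have h1 : ((d * g : G) : G ⧸ L) = g := hw ⟨d, Subgroup.mem_zpowers _⟩
  rw [eq_comm, QuotientGroup.eq, ← mul_assoc] at h1
  have hg : g⁻¹ ∉ L := fun h => hw1 (by rw [QuotientGroup.eq]; simpa using L.inv_mem h)
  have h2 := hL g⁻¹ hg d d.2 (by simpa using h1)
  have h3 : orderOf (d : G) = 1 := by rw [h2, orderOf_one]
  rw [Subgroup.orderOf_coe, hd] at h3
  exact hp.one_lt.ne' h3

-- The transfer is a product over the orbits of `h` on the cosets of `L`. The trivial coset is a
-- fixed point and contributes `ϕ h`. Any other orbit contributes `ϕ (g⁻¹ h ^ k g)` with `g ∉ L`,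
-- and malnormality forces `h ^ k = 1`.
open MulAction in
theorem Subgroup.IsMalnormal.transfer_eq {G A : Type} [Group G] [Finite G] [CommGroup A]
    {L : Subgroup G} (hL : L.IsMalnormal) (ϕ : L →* A) (h : L) : ϕ.transfer (h : G) = ϕ h := by
  classical
  have := Fintype.ofFinite (Quotient (orbitRel (Subgroup.zpowers (h : G)) (G ⧸ L)))
  rw [MonoidHom.transfer_eq_prod_quotient_orbitRel_zpowers_quot]
  have hfixed : ∀ x ∈ Subgroup.zpowers (h : G), x • ((1 : G) : G ⧸ L) = (1 : G) := by
    intro x hx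
    have hx' : x ∈ L := (Subgroup.zpowers_le.2 h.2) hx
    change ((x * 1 : G) : G ⧸ L) = _
    rw [QuotientGroup.eq]
    simpa using hx'
  let q₀ : Quotient (orbitRel (Subgroup.zpowers (h : G)) (G ⧸ L)) :=
    Quotient.mk _ ((1 : G) : G ⧸ L)
  have hq₀ : q₀.out = ((1 : G) : G ⧸ L) := by
    have h1 : (orbitRel (Subgroup.zpowers (h : G)) (G ⧸ L)) q₀.out ((1 : G) : G ⧸ L) :=
      Quotient.exact (Quotient.out_eq q₀)
    rw [orbitRel_apply] at h1
    obtain ⟨x, hx⟩ := h1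
    rw [← hx]
    exact hfixed x x.2
  rw [Finset.prod_eq_single q₀]
  · have hmem : (Quotient.out q₀.out : G) ∈ L := by
      have h1 : ((Quotient.out q₀.out : G) : G ⧸ L) = ((1 : G) : G ⧸ L) := by
        rw [QuotientGroup.out_eq', hq₀]
      rw [eq_comm, QuotientGroup.eq] at h1
      simpa using h1
    have hper : Function.minimalPeriod (fun x : G ⧸ L => (h : G) • x) q₀.out = 1 := by
      rw [Function.minimalPeriod_eq_one_iff_isFixedPt, hq₀]
      exact hfixed _ (Subgroup.mem_zpowers _)
    have heq : ∀ (k : ℕ) (hk : (Quotient.out q₀.out : G)⁻¹ * (h : G) ^ k * Quotient.out q₀.out ∈ L),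
        k = 1 → ϕ ⟨(Quotient.out q₀.out : G)⁻¹ * (h : G) ^ k * Quotient.out q₀.out, hk⟩ = ϕ h := by
      rintro k hk rfl
      have h1 : (⟨(Quotient.out q₀.out : G)⁻¹ * (h : G) ^ 1 * Quotient.out q₀.out, hk⟩ : L) =
          ⟨_, hmem⟩⁻¹ * h * ⟨_, hmem⟩ := by
        apply Subtype.ext; simp
      rw [h1, map_mul, map_mul, map_inv, mul_comm, mul_inv_cancel_left]
    exact heq _ _ hper
  · intro q _ hq
    have hout : (Quotient.out q.out : G) ∉ L := by
      intro hmem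
      apply hq
      rw [← Quotient.out_eq q]
      have : q.out = ((1 : G) : G ⧸ L) := by
        rw [← QuotientGroup.out_eq' q.out, eq_comm, QuotientGroup.eq]
        simpa using hmem
      rw [this]
    have hone : ∀ (k : ℕ) (hk : (Quotient.out q.out : G)⁻¹ * (h : G) ^ k * Quotient.out q.out ∈ L),
        ϕ ⟨(Quotient.out q.out : G)⁻¹ * (h : G) ^ k * Quotient.out q.out, hk⟩ = 1 := by
      intro k hk
      have h1 : (h : G) ^ k = 1 :=
        hL (Quotient.out q.out : G)⁻¹ (fun h2 => hout (by simpa using L.inv_mem h2)) _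
          (L.pow_mem h.2 k) (by simpa using hk)
      have h2 : (⟨_, hk⟩ : L) = 1 := Subtype.ext (by simp [h1])
      rw [h2, map_one]
    exact hone _ _
  · intro hq
    exact absurd (Finset.mem_univ _) hq

theorem Subgroup.characteristic_of_coprime_index {G : Type} [Group G] [Finite G] (N : Subgroup G)
    [N.Normal] (h : (Nat.card N).Coprime N.index) : N.Characteristic := by
  rw [Subgroup.characteristic_iff_map_le]
  rintro φ _ ⟨x, hx, rfl⟩
  have h1 : x ^ Nat.card N = 1 := by
    have := pow_card_eq_one' (x := (⟨x, hx⟩ : N))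
    exact congrArg Subtype.val this
  have h2 : (QuotientGroup.mk (φ x) : G ⧸ N) ^ Nat.card N = 1 := by
    rw [← QuotientGroup.mk_pow, ← map_pow, h1, map_one, QuotientGroup.mk_one]
  have h3 : (QuotientGroup.mk (φ x) : G ⧸ N) = 1 := by
    rw [← orderOf_eq_one_iff]
    exact Nat.eq_one_of_dvd_coprimes h (orderOf_dvd_of_pow_eq_one h2)
      (N.index_eq_card ▸ _root_.orderOf_dvd_natCard _)
  exact (QuotientGroup.eq_one_iff _).1 h3

/-- A solvable malnormal subgroup has a normal complement. -/
theorem Subgroup.IsMalnormal.exists_normal_isComplement' (n : ℕ) :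
    ∀ {G : Type} [Group G] [Finite G] {L : Subgroup G} [Group.IsSolvable L],
      L.IsMalnormal → Nat.card L = n → ∃ N : Subgroup G, N.Normal ∧ N.IsComplement' L := by
  induction n using Nat.strong_induction_on with
  | _ n ih =>
  intro G _ _ L _ hL hn
  by_cases hbot : L = ⊥
  · subst hbot
    exact ⟨⊤, inferInstance, Subgroup.isComplement'_top_bot⟩
  have : Nontrivial L := (Subgroup.nontrivial_iff_ne_bot L).2 hbot
  -- By transfer the abelianization map of `L` extends to `G`. The kernel `K` meets `L` in the
  -- commutator subgroup of `L`, which is smaller than `L` by solvability, so induction applies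
  -- inside `K`.
  let ϕ : L →* Abelianization L := Abelianization.of
  let f : G →* Abelianization L := ϕ.transfer
  have hf : ∀ l : L, f l = Abelianization.of l := fun l => hL.transfer_eq ϕ l
  let K := f.ker
  have hsolv : Group.IsSolvable (L.subgroupOf K) := by
    let g : L.subgroupOf K →* L :=
      { toFun := fun x => ⟨x.1.1, x.2⟩, map_one' := rfl, map_mul' := fun _ _ => rfl }
    exact Group.isSolvable_of_isSolvable_injective (f := g) fun a b hab =>
      Subtype.ext (Subtype.ext (congrArg (fun z : L => (z : G)) hab))
  have hlt : Nat.card (L.subgroupOf K) < n := by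
    rw [← hn]
    have := Fintype.ofFinite L
    have := Fintype.ofFinite (L.subgroupOf K)
    obtain ⟨l, hl⟩ : ∃ l : L, l ∉ _root_.commutator L := by
      by_contra! hcon
      exact (Group.IsSolvable.commutator_lt_top_of_nontrivial L).ne ((Subgroup.eq_top_iff' _).2 hcon)
    let g : L.subgroupOf K → L := fun x => ⟨x.1.1, x.2⟩
    have hg : Function.Injective g := fun a b hab =>
      Subtype.ext (Subtype.ext (congrArg (fun z : L => (z : G)) hab))
    rw [Nat.card_eq_fintype_card, Nat.card_eq_fintype_card]
    refine Fintype.card_lt_of_injective_of_notMem g hg (b := l) ?_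
    rintro ⟨x, rfl⟩
    apply hl
    have h1 : f x.1.1 = 1 := x.1.2
    rw [show (x.1.1 : G) = (g x : L) from rfl, hf, ← MonoidHom.mem_ker, Abelianization.ker_of] at h1
    exact h1
  obtain ⟨N, hN, hNL⟩ := ih _ hlt (hL.subgroupOf K) rfl
  -- The normal complement found in `K` has order prime to its index, hence is characteristic in `K`
  -- and therefore normal in `G`.
  have hcop := (hL.subgroupOf K).coprime
  rw [hNL.index_eq_card, ← hNL.symm.index_eq_card] at hcop
  have hchar := N.characteristic_of_coprime_index hcop.symm
  refine ⟨N.map K.subtype, inferInstance, ?_⟩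
  apply Subgroup.isComplement'_of_disjoint_and_mul_eq_univ
  · rw [Subgroup.disjoint_def]
    rintro _ ⟨x, hx, rfl⟩ hxL
    have := Subgroup.disjoint_def.1 hNL.disjoint hx (Subgroup.mem_subgroupOf.2 hxL)
    rw [this]; rfl
  · rw [Set.eq_univ_iff_forall]
    intro g
    obtain ⟨l, hl⟩ := (QuotientGroup.mk_surjective (f g) : ∃ l : L, Abelianization.of l = f g)
    have hk : g * (l : G)⁻¹ ∈ K := by
      rw [MonoidHom.mem_ker, map_mul, map_inv, hf]
      exact mul_inv_eq_one.2 hl.symm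
    obtain ⟨⟨x, y⟩, hxy⟩ := hNL.surjective ⟨_, hk⟩
    have hxy' : (x.1.1 : G) * y.1.1 = g * (l : G)⁻¹ := congrArg Subtype.val hxy
    refine ⟨x.1.1, ⟨x.1, x.2, rfl⟩, y.1.1 * l, L.mul_mem y.2 l.2, ?_⟩
    change x.1.1 * (y.1.1 * (l : G)) = g
    rw [← mul_assoc, hxy', inv_mul_cancel_right]

/-- An element outside of a normal complement of prime order has a conjugate in `L`, hence
commutes with no nontrivial element of the normal complement. -/
theorem Subgroup.IsMalnormal.eq_one_of_commute {G : Type} [Group G] [Finite G] {L N : Subgroup G}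
    [hN : N.Normal] (hL : L.IsMalnormal) (hNL : N.IsComplement' L) {k v : G} (hk : k ≠ 1)
    (hkc : (orderOf k).Coprime (Nat.card N)) (hv : v ∈ N) (hkv : Commute k v) : v = 1 := by
  have hord : orderOf k ≠ 1 := fun h => hk (orderOf_eq_one_iff.1 h)
  obtain ⟨p, hp, a, ha⟩ := Nat.exists_prime_and_dvd hord
  have : Fact p.Prime := ⟨hp⟩
  have ha0 : a ≠ 0 := by rintro rfl; have := orderOf_pos k; omega
  have hka : orderOf (k ^ a) = p := by
    rw [orderOf_pow_of_dvd ha0 ⟨p, by rw [ha, mul_comm]⟩, ha,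
      Nat.mul_div_cancel _ (Nat.pos_of_ne_zero ha0)]
  have hP : IsPGroup p (Subgroup.zpowers (k ^ a)) := IsPGroup.of_card (n := 1) (by
    rw [Nat.card_zpowers, hka, pow_one])
  have hpN : ¬ p ∣ Nat.card (G ⧸ L) := by
    rw [← Subgroup.index_eq_card, hNL.index_eq_card]
    intro h
    exact hp.one_lt.ne' (Nat.eq_one_of_dvd_coprimes hkc (ha ▸ dvd_mul_right _ _) h)
  -- The number of cosets of `L` is `|N|`, which is prime to `p`; a fixed coset `gL` puts `g⁻¹ k ^ a
  -- g` into `L`.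
  obtain ⟨w, hw⟩ := hP.nonempty_fixed_point_of_prime_not_dvd_card (G ⧸ L) hpN
  obtain ⟨g, rfl⟩ := QuotientGroup.mk_surjective w
  have h1 : ((k ^ a * g : G) : G ⧸ L) = g := hw ⟨k ^ a, Subgroup.mem_zpowers _⟩
  rw [eq_comm, QuotientGroup.eq] at h1
  have hne : k ^ a ≠ 1 := by
    intro h
    rw [h, orderOf_one] at hka
    exact hp.one_lt.ne hka
  have hcomm : Commute (g⁻¹ * (k ^ a * g)) (g⁻¹ * v * g) := by
    have := (hkv.pow_left a).map (MulAut.conj g⁻¹)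
    simpa [mul_assoc] using this
  have hmem : g⁻¹ * v * g ∈ N := by simpa using hN.conj_mem v hv g⁻¹
  -- This conjugate of `v` commutes with a nontrivial element of `L`, so malnormality forces it into
  -- `L`.
  have hvL : g⁻¹ * v * g ∈ L := by
    by_contra hcon
    have h2 := hL _ hcon _ h1 (by
      rw [← hcomm.eq, mul_inv_cancel_right]; exact h1)
    apply hne
    have h3 : g⁻¹ * k ^ a * g⁻¹⁻¹ = 1 := by rw [inv_inv, mul_assoc]; exact h2
    exact conj_eq_one_iff.1 h3
  have h4 := Subgroup.disjoint_def.1 hNL.disjoint hmem hvL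
  have h5 : g⁻¹ * v * g⁻¹⁻¹ = 1 := by rw [inv_inv]; exact h4
  exact conj_eq_one_iff.1 h5

/-- A subgroup `K` that normalizes a nontrivial `p`-subgroup `R` and centralizes no nontrivial
element of it has a fixed-point-free action. -/
theorem hasFixedPointFreeAction_of_normalizes {G : Type} [Group G] [Finite G] {p : ℕ}
    [Fact p.Prime] {R K : Subgroup G} (hR : IsPGroup p R) (hR1 : R ≠ ⊥)
    (hK : K ≤ Subgroup.normalizer (R : Set G))
    (hfix : ∀ k ∈ K, k ≠ 1 → ∀ v ∈ R, Commute k v → v = 1) : HasFixedPointFreeAction K := by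
  let M := Subgroup.normalizer (R : Set G)
  have : Nontrivial R := (Subgroup.nontrivial_iff_ne_bot R).2 hR1
  have hc : Nontrivial (Subgroup.center R) := hR.center_nontrivial
  let R' : Subgroup M := R.subgroupOf M
  have hR'n : R'.Normal := Subgroup.normal_in_normalizer
  let e : R' ≃* R := Subgroup.subgroupOfEquivOfLe Subgroup.le_normalizer
  -- The centre of `R` is nontrivial, abelian and normal in the normalizer of `R`, so `K` acts on it
  -- by conjugation.
  let V : Subgroup M := (Subgroup.center R').map R'.subtype
  have hVn : V.Normal := inferInstance
  let _ : CommGroup V :=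
    { (inferInstance : Group V) with
      mul_comm := by
        rintro ⟨_, x, hx, rfl⟩ ⟨_, y, hy, rfl⟩
        exact Subtype.ext (congrArg R'.subtype (Subgroup.mem_center_iff.1 hy x)) }
  refine ⟨V, inferInstance, (MulAut.conjNormal (H := V)).comp (Subgroup.inclusion hK),
    inferInstance, ?_, ?_⟩
  · obtain ⟨z, hz⟩ := exists_ne (1 : Subgroup.center R)
    refine ⟨⟨⟨_, e.symm z.1, ?_, rfl⟩, 1, ?_⟩⟩
    · rw [SetLike.mem_coe, Subgroup.mem_center_iff]
      intro g
      apply e.injective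
      rw [map_mul, map_mul, e.apply_symm_apply]
      exact Subgroup.mem_center_iff.1 z.2 _
    · intro h
      apply hz
      have h1 := congrArg Subtype.val h
      have h2 : e.symm z.1 = 1 := Subtype.ext h1
      exact Subtype.ext (e.symm.injective (by rw [h2]; exact (map_one _).symm))
  · intro k hk v hv
    have h1 := congrArg (fun x : V => ((x : M) : G)) hv
    have h2 : (k : G) * ((v : M) : G) * (k : G)⁻¹ = ((v : M) : G) := h1
    have h3 : ((v : M) : G) ∈ R := by
      obtain ⟨x, -, hx⟩ := v.2
      rw [← hx]
      exact x.2
    have h4 := hfix k k.2 (fun h => hk (Subtype.ext h)) _ h3 (mul_inv_eq_iff_eq_mul.1 h2)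
    exact Subtype.ext (Subtype.ext h4)

theorem HasFixedPointFreeAction.of_mulEquiv {H K : Type} [Group H] [Group K]
    (hK : HasFixedPointFreeAction K) (e : H ≃* K) : HasFixedPointFreeAction H := by
  obtain ⟨V, _, ρ, hV, hV1, hfix⟩ := hK
  exact ⟨V, inferInstance, ρ.comp e.toMonoidHom, hV, hV1, fun h hh v hv =>
    hfix (e h) (fun h1 => hh (e.injective (h1.trans (map_one e).symm))) v hv⟩

/-- A solvable Frobenius complement has a fixed-point-free action on an abelian group. -/
theorem IsFrobeniusComplement.hasFixedPointFreeAction {H : Type} [Group H]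
    (hH : IsFrobeniusComplement H) [hs : Group.IsSolvable H] : HasFixedPointFreeAction H := by
  obtain ⟨G, _, L, _, hFL, ⟨e⟩⟩ := hH
  have : Group.IsSolvable L := Group.isSolvable_of_isSolvable_injective (f := e.symm.toMonoidHom)
    e.symm.injective
  have hL := hFL.isMalnormal
  obtain ⟨N, hN, hNL⟩ := hL.exists_normal_isComplement' _ rfl
  have hcop : (Nat.card N).Coprime (Nat.card L) := by
    have := hL.coprime
    rwa [hNL.index_eq_card, Nat.coprime_comm] at this
  have hcard := hNL.card_mul_card
  have hN1 : Nat.card N ≠ 1 := by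
    intro h
    rw [h, one_mul] at hcard
    exact hFL.2.1 (Subgroup.eq_top_of_card_eq _ hcard)
  obtain ⟨p, hp, hpN⟩ := Nat.exists_prime_and_dvd hN1
  have : Fact p.Prime := ⟨hp⟩
  let P : Sylow p N := default
  let R : Subgroup G := (P : Subgroup N).map N.subtype
  let M := Subgroup.normalizer (R : Set G)
  -- By Frattini's argument `N ∩ M` has index `|L|` in `M`, and Schur–Zassenhaus yields a complement
  -- to it that normalizes `R`.
  have hMN : M ⊔ N = ⊤ := P.normalizer_sup_eq_top
  have hindex : (N.subgroupOf M).index = Nat.card L := by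
    rw [← hNL.symm.index_eq_card, ← Subgroup.relIndex_top_right N, ← hMN,
      Subgroup.relIndex_sup_right]
    rfl
  have hcardM : Nat.card (N.subgroupOf M) ∣ Nat.card N :=
    Subgroup.card_dvd_of_injective
      ({ toFun := fun x => ⟨x.1.1, x.2⟩, map_one' := rfl, map_mul' := fun _ _ => rfl } :
        N.subgroupOf M →* N)
      fun a b hab => Subtype.ext (Subtype.ext (congrArg (fun z : N => (z : G)) hab))
  obtain ⟨K, hK⟩ := Subgroup.exists_right_complement'_of_coprime
    (hindex ▸ Nat.Coprime.of_dvd_left hcardM hcop : (Nat.card (N.subgroupOf M)).Coprime _)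
  let K' : Subgroup G := K.map M.subtype
  have hK'card : Nat.card K' = Nat.card L := by
    rw [← hindex, hK.symm.index_eq_card]
    exact Nat.card_congr (K.equivMapOfInjective _ M.subtype_injective).symm.toEquiv
  have hK' : N.IsComplement' K' :=
    Subgroup.isComplement'_of_coprime (by rw [hK'card, hcard]) (by rw [hK'card]; exact hcop)
  have hR1 : R ≠ ⊥ := by
    intro h
    have h1 : (P : Subgroup N) = ⊥ := (Subgroup.map_eq_bot_iff_of_injective _
      N.subtype_injective).1 h
    have h2 := P.dvd_card_of_dvd_card hpN
    rw [h1, Subgroup.card_bot] at h2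
    exact hp.one_lt.ne' (Nat.dvd_one.1 h2)
  have hfp : HasFixedPointFreeAction K' := by
    refine hasFixedPointFreeAction_of_normalizes (P.2.map N.subtype) hR1
      (Subgroup.map_subtype_le K) ?_
    intro k hk hk1 v hv hkv
    refine hL.eq_one_of_commute hNL hk1 ?_ (Subgroup.map_subtype_le _ hv) hkv
    refine Nat.Coprime.of_dvd_left ?_ hcop.symm
    rw [← hK'card, ← Subgroup.orderOf_mk k hk]
    exact orderOf_dvd_natCard _
  -- Both `L` and `K'` are complements of `N`, hence isomorphic to `G ⧸ N`.
  exact hfp.of_mulEquiv (e.trans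
    (hNL.symm.QuotientMulEquiv.symm.trans hK'.symm.QuotientMulEquiv))

/-! ### The action on the commutator subgroup -/

/-- `y` generates `H` modulo the commutator subgroup and acts on the latter as the `r`-th power. -/
def GeneratesWithPower {H : Type} [Group H] (y : H) (r : ℕ) : Prop :=
  Subgroup.zpowers y ⊔ commutator H = ⊤ ∧ ∀ x ∈ commutator H, y * x * y⁻¹ = x ^ r

/-- Some generator of `H` modulo the commutator subgroup acts on the latter as the `r`-th power. -/
def HasCommutatorAction (H : Type) [Group H] (r : ℕ) : Prop :=
  ∃ y : H, GeneratesWithPower y r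

section Action

variable {H : Type} [Group H]

theorem GeneratesWithPower.pow_conj {y : H} {r : ℕ} (hy : GeneratesWithPower y r) (j : ℕ) :
    ∀ x ∈ commutator H, y ^ j * x * (y ^ j)⁻¹ = x ^ r ^ j := by
  induction j with
  | zero => simp
  | succ j ih =>
    intro x hx
    have h1 : y ^ (j + 1) * x * (y ^ (j + 1))⁻¹ = y ^ j * (y * x * y⁻¹) * (y ^ j)⁻¹ := by
      rw [pow_succ]; group
    rw [h1, hy.2 x hx, ih _ (Subgroup.pow_mem _ hx r), ← pow_mul, pow_succ']

theorem GeneratesWithPower.exists_eq_pow_mul [Finite H] {y : H} {r : ℕ}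
    (hy : GeneratesWithPower y r) (h : H) : ∃ (j : ℕ), ∃ z ∈ commutator H, h = y ^ j * z := by
  have : h ∈ Subgroup.zpowers y ⊔ commutator H := hy.1 ▸ Subgroup.mem_top h
  obtain ⟨w, hw, z, hz, rfl⟩ := Subgroup.mem_sup_of_normal_right.1 this
  obtain ⟨j, rfl⟩ := mem_powers_iff_mem_zpowers.2 hw
  exact ⟨j, z, hz, rfl⟩

theorem GeneratesWithPower.congr {y : H} {r r' : ℕ} (hy : GeneratesWithPower y r)
    (h : (r : ZMod (Nat.card (commutator H))) = r') : GeneratesWithPower y r' := by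
  refine ⟨hy.1, fun x hx => ?_⟩
  rw [hy.2 x hx, pow_eq_pow_iff_modEq]
  rw [ZMod.natCast_eq_natCast_iff] at h
  exact h.of_dvd (Subgroup.orderOf_dvd_natCard _ hx)

theorem HasCommutatorAction.congr {r r' : ℕ} (hy : HasCommutatorAction H r)
    (h : (r : ZMod (Nat.card (commutator H))) = r') : HasCommutatorAction H r' :=
  let ⟨y, hy⟩ := hy
  ⟨y, hy.congr h⟩

theorem GeneratesWithPower.pow [Finite H] {y : H} {r : ℕ} (hy : GeneratesWithPower y r) {j : ℕ}
    (hj : j.Coprime (commutator H).index) : GeneratesWithPower (y ^ j) (r ^ j) := by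
  refine ⟨?_, hy.pow_conj j⟩
  rw [eq_top_iff, ← hy.1, sup_le_iff]
  refine ⟨?_, le_sup_right⟩
  rw [Subgroup.zpowers_le]
  have hord : orderOf (y : H ⧸ commutator H) ∣ (commutator H).index := by
    rw [Subgroup.index_eq_card]
    exact orderOf_dvd_natCard _
  obtain ⟨a, ha⟩ := exists_pow_eq_self_of_coprime (hj.of_dvd_right hord)
  rw [← QuotientGroup.mk_pow, ← QuotientGroup.mk_pow, QuotientGroup.eq] at ha
  rw [← Subgroup.mul_mem_cancel_left _ (Subgroup.inv_mem _
    (Subgroup.pow_mem _ (Subgroup.mem_sup_left (Subgroup.mem_zpowers (y ^ j))) a))]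
  exact Subgroup.mem_sup_right ha

variable [Finite H] [hZ : IsZGroup H]

theorem IsZGroup.commutator_comm : ∀ a ∈ commutator H, ∀ b ∈ commutator H, a * b = b * a := by
  have := IsZGroup.isCyclic_commutator (G := H)
  intro a ha b hb
  let _ : CommGroup (commutator H) := IsCyclic.commGroup
  exact congrArg Subtype.val (mul_comm (⟨a, ha⟩ : commutator H) ⟨b, hb⟩)

variable (H) in
theorem IsZGroup.exists_commutator_generator : ∃ c ∈ commutator H,
    orderOf c = Nat.card (commutator H) ∧ ∀ x ∈ commutator H, ∃ k : ℕ, x = c ^ k := by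
  have := IsZGroup.isCyclic_commutator (G := H)
  obtain ⟨c, hc⟩ := IsCyclic.exists_monoid_generator (α := commutator H)
  refine ⟨c, c.2, ?_, ?_⟩
  · rw [Subgroup.orderOf_coe]
    exact orderOf_eq_card_of_forall_mem_zpowers fun x => mem_powers_iff_mem_zpowers.1 (hc x)
  · intro x hx
    obtain ⟨k, hk⟩ := hc ⟨x, hx⟩
    exact ⟨k, (congrArg Subtype.val hk).symm⟩

variable (H) in
theorem IsZGroup.exists_hasCommutatorAction : ∃ r, HasCommutatorAction H r := by
  obtain ⟨c, hc, -, hgen⟩ := IsZGroup.exists_commutator_generator H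
  obtain ⟨a, ha⟩ := IsCyclic.exists_generator (α := Abelianization H)
  obtain ⟨y, rfl⟩ := (QuotientGroup.mk_surjective a : ∃ y : H, Abelianization.of y = a)
  have hconj : ∀ x ∈ commutator H, y * x * y⁻¹ ∈ commutator H := fun x hx =>
    (inferInstance : (commutator H).Normal).conj_mem x hx y
  obtain ⟨r, hr⟩ := hgen _ (hconj c hc)
  refine ⟨r, y, ?_, ?_⟩
  · rw [Subgroup.eq_top_iff']
    intro h
    rw [Subgroup.mem_sup_of_normal_right]
    obtain ⟨k, hk⟩ := ha (Abelianization.of h)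
    refine ⟨y ^ k, ⟨k, rfl⟩, (y ^ k)⁻¹ * h, ?_, by group⟩
    rw [← Abelianization.ker_of, MonoidHom.mem_ker, map_mul, map_inv, map_zpow]
    exact inv_mul_eq_one.2 hk
  · intro x hx
    obtain ⟨k, rfl⟩ := hgen x hx
    rw [← conj_pow, hr, ← pow_mul, ← pow_mul, mul_comm]

/-- Modulo the commutator subgroup, `y'` is a power `y ^ j`, and the abelian commutator subgroup
acts trivially on itself. With the roles exchanged as well, the subgroup generated by `r` is an
invariant of `H`. -/
theorem HasCommutatorAction.exists_eq_pow {r r' : ℕ} (h : HasCommutatorAction H r)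
    (h' : HasCommutatorAction H r') :
    ∃ j : ℕ, (r' : ZMod (Nat.card (commutator H))) = (r : ZMod (Nat.card (commutator H))) ^ j := by
  obtain ⟨y, hy⟩ := h
  obtain ⟨y', hy'⟩ := h'
  obtain ⟨c, hc, hord, -⟩ := IsZGroup.exists_commutator_generator H
  obtain ⟨j, z, hz, rfl⟩ := hy.exists_eq_pow_mul y'
  refine ⟨j, ?_⟩
  have h1 := hy'.2 c hc
  have h2 : y ^ j * z * c * (y ^ j * z)⁻¹ = y ^ j * c * (y ^ j)⁻¹ := by
    rw [mul_assoc (y ^ j) z c, IsZGroup.commutator_comm z hz c hc]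
    group
  rw [h2, hy.pow_conj j c hc, pow_eq_pow_iff_modEq, hord, ← ZMod.natCast_eq_natCast_iff] at h1
  rw [← h1, Nat.cast_pow]

/-- Let `c` generate the commutator subgroup. Modulo the normal subgroup generated by `c ^ (r - 1)`,
the images of `y` and `c` commute and generate, so the quotient is abelian. Hence `c` is itself a
power of `c ^ (r - 1)`. -/
theorem GeneratesWithPower.isUnit_sub_one {y : H} {r : ℕ} (hy : GeneratesWithPower y r) :
    IsUnit ((r : ZMod (Nat.card (commutator H))) - 1) := by
  obtain ⟨c, hc, hord, hgen⟩ := IsZGroup.exists_commutator_generator H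
  let D := Subgroup.zpowers (c ^ r * c⁻¹)
  have hDC : D ≤ commutator H := by
    rw [Subgroup.zpowers_le]
    exact mul_mem (pow_mem hc r) (inv_mem hc)
  have hD : D.Normal := by
    refine ⟨fun d hd g => ?_⟩
    obtain ⟨j, z, hz, rfl⟩ := hy.exists_eq_pow_mul g
    have h2 : y ^ j * z * d * (y ^ j * z)⁻¹ = y ^ j * d * (y ^ j)⁻¹ := by
      rw [mul_assoc (y ^ j) z d, IsZGroup.commutator_comm z hz d (hDC hd)]
      group
    rw [h2, hy.pow_conj j d (hDC hd)]
    exact pow_mem hd _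
  have hle : commutator H ≤ D := by
    rw [← Subgroup.Normal.quotient_commutative_iff_commutator_le]
    have hcy : Commute (y : H ⧸ D) (c : H ⧸ D) := by
      rw [Commute, SemiconjBy, ← QuotientGroup.mk_mul, ← QuotientGroup.mk_mul, eq_comm,
        QuotientGroup.eq]
      have h1 : (c * y)⁻¹ * (y * c) = y⁻¹ * (c⁻¹ * (y * c * y⁻¹)) * y⁻¹⁻¹ := by group
      rw [h1, hy.2 c hc, IsZGroup.commutator_comm _ (inv_mem hc) _ (pow_mem hc r)]
      exact hD.conj_mem _ (Subgroup.mem_zpowers _) _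
    have hall : ∀ g : H, ∃ i k : ℕ, (g : H ⧸ D) = (y : H ⧸ D) ^ i * (c : H ⧸ D) ^ k := by
      intro g
      obtain ⟨i, z, hz, rfl⟩ := hy.exists_eq_pow_mul g
      obtain ⟨k, rfl⟩ := hgen z hz
      exact ⟨i, k, rfl⟩
    refine ⟨⟨fun a b => ?_⟩⟩
    obtain ⟨g, rfl⟩ := QuotientGroup.mk_surjective a
    obtain ⟨h, rfl⟩ := QuotientGroup.mk_surjective b
    obtain ⟨i, k, hg⟩ := hall g
    obtain ⟨i', k', hh⟩ := hall h
    rw [hg, hh]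
    have e1 := hcy.pow_pow i k'
    have e2 := hcy.symm.pow_pow k i'
    exact (((Commute.refl _).pow_pow i i').mul_left e2).mul_right
      (e1.mul_left ((Commute.refl _).pow_pow k k'))
  obtain ⟨k, hk⟩ := hle hc
  have h1 : c ^ (((r : ℤ) - 1) * k) = c ^ (1 : ℤ) := by
    rw [zpow_mul, zpow_one, zpow_sub, zpow_natCast, zpow_one]
    exact hk
  rw [zpow_eq_zpow_iff_modEq, hord, ← ZMod.intCast_eq_intCast_iff] at h1
  push_cast at h1
  exact IsUnit.of_mul_eq_one _ h1

theorem GeneratesWithPower.eq_one_of_pow_eq {y : H} {r : ℕ} (hy : GeneratesWithPower y r) {x : H}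
    (hx : x ∈ commutator H) (h : x ^ r = x) : x = 1 := by
  obtain ⟨c, hc, hord, hgen⟩ := IsZGroup.exists_commutator_generator H
  obtain ⟨k, rfl⟩ := hgen x hx
  have h1 : c ^ (k * r) = c ^ k := by rw [pow_mul, h]
  rw [pow_eq_pow_iff_modEq, hord, ← ZMod.natCast_eq_natCast_iff] at h1
  push_cast at h1
  have h2 : (k : ZMod (Nat.card (commutator H))) * (r - 1) = 0 := by
    rw [mul_sub, h1, mul_one, sub_self]
  rw [hy.isUnit_sub_one.mul_left_eq_zero, ZMod.natCast_eq_zero_iff, ← hord,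
    orderOf_dvd_iff_pow_eq_one] at h2
  exact h2

/-- With `n` the index, `y ^ n` is an element of the commutator subgroup fixed by `y`, and it is
trivial because `r - 1` is a unit. This is what splits the extension. -/
theorem GeneratesWithPower.orderOf_eq {y : H} {r : ℕ} (hy : GeneratesWithPower y r) :
    orderOf y = (commutator H).index := by
  apply Nat.dvd_antisymm
  · apply orderOf_dvd_of_pow_eq_one
    have hmem := (commutator H).pow_index_mem y
    refine hy.eq_one_of_pow_eq hmem ?_
    rw [← hy.2 _ hmem]
    group
  · have h1 : ∀ q : H ⧸ commutator H, q ∈ Subgroup.zpowers ((y : H) : H ⧸ commutator H) := by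
      intro q
      obtain ⟨g, rfl⟩ := QuotientGroup.mk_surjective q
      obtain ⟨j, z, hz, rfl⟩ := hy.exists_eq_pow_mul g
      refine ⟨j, ?_⟩
      change (y : H ⧸ commutator H) ^ (j : ℤ) = _
      rw [zpow_natCast, QuotientGroup.mk_mul, (QuotientGroup.eq_one_iff z).2 hz, mul_one,
        QuotientGroup.mk_pow]
    rw [Subgroup.index_eq_card, ← orderOf_eq_card_of_forall_mem_zpowers h1]
    exact orderOf_map_dvd (QuotientGroup.mk' (commutator H)) y

theorem GeneratesWithPower.pow_conj_eq_self_iff {y : H} {r : ℕ} (hy : GeneratesWithPower y r)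
    (j : ℕ) : (∀ x ∈ commutator H, y ^ j * x * (y ^ j)⁻¹ = x) ↔
      orderOf (r : ZMod (Nat.card (commutator H))) ∣ j := by
  obtain ⟨c, hc, hord, hgen⟩ := IsZGroup.exists_commutator_generator H
  rw [orderOf_dvd_iff_pow_eq_one]
  constructor
  · intro h
    have h1 := h c hc
    rw [hy.pow_conj j c hc] at h1
    nth_rewrite 2 [← pow_one c] at h1
    rw [pow_eq_pow_iff_modEq, hord, ← ZMod.natCast_eq_natCast_iff] at h1
    simpa using h1
  · intro h x hx
    rw [hy.pow_conj j x hx]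
    nth_rewrite 2 [← pow_one x]
    rw [pow_eq_pow_iff_modEq]
    refine Nat.ModEq.of_dvd (Subgroup.orderOf_dvd_natCard _ hx) ?_
    rw [← ZMod.natCast_eq_natCast_iff]
    simpa using h

theorem GeneratesWithPower.orderOf_dvd {y : H} {r : ℕ} (hy : GeneratesWithPower y r) :
    orderOf (r : ZMod (Nat.card (commutator H))) ∣ (commutator H).index := by
  rw [← hy.pow_conj_eq_self_iff, ← hy.orderOf_eq, pow_orderOf_eq_one]
  simp

/-- In a Sylow-cyclic Frobenius complement, the elements of prime order centralize the commutator
subgroup, which is a condition on the order of the action. -/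
theorem HasFixedPointFreeAction.orderOf_mul_radical_dvd (hH : HasFixedPointFreeAction H) {r : ℕ}
    (h : HasCommutatorAction H r) :
    orderOf (r : ZMod (Nat.card (commutator H))) *
      radical₀ (orderOf (r : ZMod (Nat.card (commutator H)))) ∣ (commutator H).index := by
  obtain ⟨y, hy⟩ := h
  have hdvd := hy.orderOf_dvd
  have hn := (commutator H).index_ne_zero_of_finite
  set t := orderOf (r : ZMod (Nat.card (commutator H))) with ht
  obtain ⟨d, hd⟩ := hdvd
  rw [hd]
  apply mul_dvd_mul_left
  refine Finset.prod_primes_dvd _ (fun p hp => (Nat.prime_of_mem_primeFactors hp).prime) ?_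
  intro p hp
  have hpp := Nat.prime_of_mem_primeFactors hp
  obtain ⟨e, he⟩ := Nat.dvd_of_mem_primeFactors hp
  have hed : e * d ≠ 0 := by
    intro h0
    rw [hd, he, mul_assoc, h0, mul_zero] at hn
    exact hn rfl
  -- With `t = p e` and index `t d`, this power of `y` has prime order and so centralizes the
  -- commutator subgroup. Thus `p e ∣ e d`, that is, `p ∣ d`.
  have hord : orderOf (y ^ (e * d)) = p := by
    rw [orderOf_pow_of_dvd hed (by rw [hy.orderOf_eq, hd, he, mul_assoc]; exact dvd_mul_left _ _),
      hy.orderOf_eq, hd, he, mul_assoc, Nat.mul_div_cancel _ (Nat.pos_of_ne_zero hed)]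
  have hcomm := hH.commute_of_prime_order (commutator H) IsZGroup.commutator_comm (hord ▸ hpp)
  have h1 : t ∣ e * d := by
    rw [ht, ← hy.pow_conj_eq_self_iff]
    intro x hx
    rw [hcomm x hx, mul_inv_cancel_right]
  rw [he, mul_comm p e] at h1
  exact Nat.dvd_of_mul_dvd_mul_left (Nat.pos_of_ne_zero (left_ne_zero_of_mul hed)) h1

end Action

/-! ### The metacyclic models -/

theorem ofAdd_one_generates (n : ℕ) (x : Multiplicative (ZMod n)) :
    x ∈ Subgroup.zpowers (Multiplicative.ofAdd (1 : ZMod n)) := by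
  obtain ⟨k, hk⟩ := ZMod.intCast_surjective x.toAdd
  refine ⟨k, ?_⟩
  apply Multiplicative.toAdd.injective
  simp [← hk]

theorem orderOf_ofAdd_one (n : ℕ) : orderOf (Multiplicative.ofAdd (1 : ZMod n)) = n := by
  rw [orderOf_ofAdd_eq_addOrderOf, ZMod.addOrderOf_one]

theorem eq_ofAdd_one_pow {n : ℕ} [NeZero n] (x : Multiplicative (ZMod n)) :
    ∃ k : ℕ, x = Multiplicative.ofAdd (1 : ZMod n) ^ k := by
  obtain ⟨k, hk⟩ := mem_powers_iff_mem_zpowers.2 (ofAdd_one_generates n x)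
  exact ⟨k, hk.symm⟩

/-- The power automorphism of a cyclic group given by a unit. -/
theorem exists_mulAut_pow {m n : ℕ} {r : ℕ} (hn : n ≠ 0) (hr : (r : ZMod m) ^ n = 1) :
    ∃ φ : Multiplicative (ZMod n) →* MulAut (Multiplicative (ZMod m)),
      ∀ x, φ (Multiplicative.ofAdd 1) x = x ^ r := by
  have hu : IsUnit (r : ZMod m) := IsUnit.of_pow_eq_one hr hn
  obtain ⟨s, hs⟩ := hu.exists_right_inv
  let σ : MulAut (Multiplicative (ZMod m)) :=
    { toFun := fun x => x ^ r
      invFun := fun x => Multiplicative.ofAdd (s * x.toAdd)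
      left_inv := fun x => by
        apply Multiplicative.toAdd.injective
        simp [mul_comm s, mul_right_comm, hs]
      right_inv := fun x => by
        apply Multiplicative.toAdd.injective
        simp [← mul_assoc, hs]
      map_mul' := fun x y => mul_pow x y r }
  have hσ : ∀ (k : ℕ) (x : Multiplicative (ZMod m)), (σ ^ k) x = x ^ r ^ k := by
    intro k
    induction k with
    | zero => simp
    | succ k ih =>
      intro x
      rw [pow_succ, MulAut.mul_apply, ih, pow_succ', pow_mul]
      rfl
  refine ⟨monoidHomOfForallMemZpowers (ofAdd_one_generates n) (g' := σ) ?_, ?_⟩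
  · rw [orderOf_ofAdd_one]
    apply orderOf_dvd_of_pow_eq_one
    ext x
    apply Multiplicative.toAdd.injective
    rw [hσ]
    simp [hr]
  · intro x
    rw [monoidHomOfForallMemZpowers_apply_gen]
    rfl

section Model

variable {m n r : ℕ} {φ : Multiplicative (ZMod n) →* MulAut (Multiplicative (ZMod m))}

theorem model_action_pow (hφ : ∀ x, φ (Multiplicative.ofAdd 1) x = x ^ r) (k : ℕ)
    (x : Multiplicative (ZMod m)) : φ (Multiplicative.ofAdd 1 ^ k) x = x ^ r ^ k := by
  induction k generalizing x with
  | zero => simp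
  | succ k ih => rw [pow_succ, map_mul, MulAut.mul_apply, ih, hφ, ← pow_mul, pow_succ']

theorem model_action_pow_eq_one_iff (hφ : ∀ x, φ (Multiplicative.ofAdd 1) x = x ^ r) (k : ℕ) :
    φ (Multiplicative.ofAdd 1 ^ k) = 1 ↔ orderOf (r : ZMod m) ∣ k := by
  rw [orderOf_dvd_iff_pow_eq_one]
  constructor
  · intro h
    have h1 := DFunLike.congr_fun h (Multiplicative.ofAdd 1)
    rw [model_action_pow hφ] at h1
    simpa using congrArg Multiplicative.toAdd h1
  · intro h
    ext x
    apply Multiplicative.toAdd.injective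
    rw [model_action_pow hφ]
    simp [h]

/-- A Sylow-cyclic group is determined by the orders of the commutator subgroup and of its quotient,
and by the action. -/
theorem HasCommutatorAction.nonempty_mulEquiv_model {H : Type} [Group H] [Finite H] [IsZGroup H]
    (h : HasCommutatorAction H r) (hm : Nat.card (commutator H) = m)
    (hn : (commutator H).index = n) (hφ : ∀ x, φ (Multiplicative.ofAdd 1) x = x ^ r) :
    Nonempty (Multiplicative (ZMod m) ⋊[φ] Multiplicative (ZMod n) ≃* H) := by
  obtain ⟨y, hy⟩ := h
  have hm0 : NeZero m := ⟨hm ▸ Nat.card_pos.ne'⟩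
  have hn0 : NeZero n := ⟨hn ▸ Subgroup.index_ne_zero_of_finite⟩
  have := IsZGroup.isCyclic_commutator (G := H)
  have hcard : Nat.card (Multiplicative (ZMod m)) = Nat.card (commutator H) := by
    rw [hm]; simp
  let e : Multiplicative (ZMod m) ≃* commutator H := mulEquivOfCyclicCardEq hcard
  let fn : Multiplicative (ZMod m) →* H := (commutator H).subtype.comp e.toMonoidHom
  let fg : Multiplicative (ZMod n) →* H := monoidHomOfForallMemZpowers (ofAdd_one_generates n)
    (g' := y) (by rw [orderOf_ofAdd_one, hy.orderOf_eq, hn])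
  have hfg : fg (Multiplicative.ofAdd 1) = y := monoidHomOfForallMemZpowers_apply_gen _ _
  let F : Multiplicative (ZMod m) ⋊[φ] Multiplicative (ZMod n) →* H :=
    SemidirectProduct.lift fn fg (by
      intro g
      obtain ⟨k, rfl⟩ := eq_ofAdd_one_pow g
      refine MonoidHom.ext fun x => ?_
      change fn (φ (Multiplicative.ofAdd 1 ^ k) x) =
        fg (Multiplicative.ofAdd 1 ^ k) * fn x * (fg (Multiplicative.ofAdd 1 ^ k))⁻¹
      rw [model_action_pow hφ, map_pow fg, hfg, hy.pow_conj k (fn x) (e x).2, map_pow])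
  have hF : Function.Bijective F := by
    have : Finite (Multiplicative (ZMod m) ⋊[φ] Multiplicative (ZMod n)) :=
      Finite.of_equiv _ SemidirectProduct.equivProd.symm
    rw [Nat.bijective_iff_surjective_and_card]
    refine ⟨fun g => ?_, ?_⟩
    · obtain ⟨j, z, hz, rfl⟩ := hy.exists_eq_pow_mul g
      refine ⟨SemidirectProduct.inr (Multiplicative.ofAdd 1 ^ j) *
        SemidirectProduct.inl (e.symm ⟨z, hz⟩), ?_⟩
      rw [map_mul, SemidirectProduct.lift_inl, SemidirectProduct.lift_inr, map_pow, hfg]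
      simp [fn]
    · rw [SemidirectProduct.card, ← (commutator H).card_mul_index, hm, hn]
      simp
  exact ⟨MulEquiv.ofBijective F hF⟩

theorem HasCommutatorAction.nonempty_mulEquiv {H K : Type} [Group H] [Finite H] [IsZGroup H]
    [Group K] [Finite K] [IsZGroup K] (h : HasCommutatorAction H r) (k : HasCommutatorAction K r)
    (hm : Nat.card (commutator H) = Nat.card (commutator K))
    (hn : (commutator H).index = (commutator K).index) : Nonempty (H ≃* K) := by
  obtain ⟨y, hy⟩ := h
  obtain ⟨φ, hφ⟩ := exists_mulAut_pow (Subgroup.index_ne_zero_of_finite (H := commutator H))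
    (orderOf_dvd_iff_pow_eq_one.1 hy.orderOf_dvd)
  obtain ⟨e⟩ := HasCommutatorAction.nonempty_mulEquiv_model ⟨y, hy⟩ rfl rfl hφ
  obtain ⟨f⟩ := k.nonempty_mulEquiv_model hm.symm hn.symm hφ
  exact ⟨e.symm.trans f⟩

theorem model_isZGroup [NeZero m] [NeZero n] (hmn : m.Coprime n) :
    IsZGroup (Multiplicative (ZMod m) ⋊[φ] Multiplicative (ZMod n)) :=
  isZGroup_of_coprime (f := SemidirectProduct.inl) (f' := SemidirectProduct.rightHom)
    SemidirectProduct.range_inl_eq_ker_rightHom.ge (by simpa using hmn)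

/-- The quotient `C_n` is abelian, which bounds the commutator subgroup. Conversely, as `r - 1` is
invertible, every `x` in `C_m` is `w ^ r w⁻¹`, a commutator with the generator of `C_n`. -/
theorem model_commutator (hφ : ∀ x, φ (Multiplicative.ofAdd 1) x = x ^ r)
    (hr : IsUnit ((r : ZMod m) - 1)) :
    commutator (Multiplicative (ZMod m) ⋊[φ] Multiplicative (ZMod n)) =
      (SemidirectProduct.inl : _ →* Multiplicative (ZMod m) ⋊[φ] Multiplicative (ZMod n)).range := by
  apply le_antisymm
  · rw [SemidirectProduct.range_inl_eq_ker_rightHom]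
    exact Abelianization.commutator_subset_ker _
  · rintro _ ⟨x, rfl⟩
    obtain ⟨s, hs⟩ := hr.exists_right_inv
    let w : Multiplicative (ZMod m) := Multiplicative.ofAdd (s * x.toAdd)
    have hx : x = w ^ r * w⁻¹ := by
      apply Multiplicative.toAdd.injective
      rw [toAdd_mul, toAdd_pow, toAdd_inv, nsmul_eq_mul]
      change x.toAdd = r * (s * x.toAdd) + -(s * x.toAdd)
      linear_combination -x.toAdd * hs
    rw [hx, ← hφ w, map_mul, SemidirectProduct.inl_aut, map_inv, map_inv,
      ← commutatorElement_def, commutator_def]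
    exact Subgroup.commutator_mem_commutator (Subgroup.mem_top _) (Subgroup.mem_top _)

theorem model_hasCommutatorAction [NeZero n] (hφ : ∀ x, φ (Multiplicative.ofAdd 1) x = x ^ r)
    (hr : IsUnit ((r : ZMod m) - 1)) :
    HasCommutatorAction (Multiplicative (ZMod m) ⋊[φ] Multiplicative (ZMod n)) r := by
  refine ⟨SemidirectProduct.inr (Multiplicative.ofAdd 1), ?_, ?_⟩
  · rw [Subgroup.eq_top_iff']
    intro g
    rw [← SemidirectProduct.inl_left_mul_inr_right g, model_commutator hφ hr]
    refine mul_mem (Subgroup.mem_sup_right ⟨_, rfl⟩) (Subgroup.mem_sup_left ?_)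
    obtain ⟨k, hk⟩ := eq_ofAdd_one_pow g.right
    rw [hk, map_pow]
    exact pow_mem (Subgroup.mem_zpowers _) k
  · rw [model_commutator hφ hr]
    rintro _ ⟨x, rfl⟩
    rw [← map_inv, ← SemidirectProduct.inl_aut, hφ, map_pow]

/-- The kernel `A` of the action on `C_m` is abelian, hence cyclic as all Sylow subgroups are.
Suppose an element of prime order `q` has `C_n`-component `k` and lies outside `A`. Then `q ∣ t`, so
`t q ∣ n ∣ k q` and `t ∣ k`, a contradiction. -/
theorem model_hasFixedPointFreeAction [NeZero m] [NeZero n] (hmn : m.Coprime n)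
    (hφ : ∀ x, φ (Multiplicative.ofAdd 1) x = x ^ r)
    (ht : orderOf (r : ZMod m) * radical₀ (orderOf (r : ZMod m)) ∣ n) :
    HasFixedPointFreeAction (Multiplicative (ZMod m) ⋊[φ] Multiplicative (ZMod n)) := by
  let M := Multiplicative (ZMod m) ⋊[φ] Multiplicative (ZMod n)
  have : Finite M := Finite.of_equiv _ SemidirectProduct.equivProd.symm
  have : IsZGroup M := model_isZGroup hmn
  let A : Subgroup M := (φ.comp SemidirectProduct.rightHom).ker
  have hA : ∀ a b : A, a * b = b * a := by
    intro a b
    have ha : φ a.1.right = 1 := a.2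
    have hb : φ b.1.right = 1 := b.2
    apply Subtype.ext
    apply SemidirectProduct.ext
    · change a.1.left * φ a.1.right b.1.left = b.1.left * φ b.1.right a.1.left
      rw [ha, hb, MulAut.one_apply, MulAut.one_apply, mul_comm]
    · exact mul_comm a.1.right b.1.right
  have : Group.IsNilpotent A := by
    let _ : CommGroup A := { (inferInstance : Group A) with mul_comm := hA }
    exact CommGroup.isNilpotent
  have : IsCyclic A := inferInstance
  refine hasFixedPointFreeAction_of_isCyclic A ?_
  intro h hprime
  have hpow : h.right ^ orderOf h = 1 := by
    have := congrArg SemidirectProduct.rightHom (pow_orderOf_eq_one h)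
    rwa [map_pow, map_one] at this
  change φ h.right = 1
  set q := orderOf h
  set t := orderOf (r : ZMod m)
  obtain ⟨k, hk⟩ := eq_ofAdd_one_pow h.right
  rw [hk] at hpow ⊢
  by_contra hne
  have h1 : orderOf (φ (Multiplicative.ofAdd 1 ^ k)) = q :=
    (hprime.eq_one_or_self_of_dvd _ (orderOf_dvd_of_pow_eq_one (by
      rw [← map_pow, hpow, map_one]))).resolve_left (fun h => hne (orderOf_eq_one_iff.1 h))
  have h2 : q ∣ t := by
    rw [← h1]
    apply orderOf_dvd_of_pow_eq_one
    rw [← map_pow, ← pow_mul, model_action_pow_eq_one_iff hφ]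
    exact dvd_mul_left _ _
  have ht0 : t ≠ 0 := by
    intro h0
    rw [h0, zero_mul, zero_dvd_iff] at ht
    exact NeZero.ne n ht
  have h3 : q ∣ radical₀ t :=
    Finset.dvd_prod_of_mem _ (Nat.mem_primeFactors.2 ⟨hprime, h2, ht0⟩)
  rw [← pow_mul, ← orderOf_dvd_iff_pow_eq_one, orderOf_ofAdd_one] at hpow
  have h4 : t * q ∣ k * q := ((mul_dvd_mul_left t h3).trans ht).trans hpow
  exact hne ((model_action_pow_eq_one_iff hφ k).2 (Nat.dvd_of_mul_dvd_mul_right hprime.pos h4))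

/-- Existence of Sylow-cyclic Frobenius complements with given invariants. -/
theorem exists_complement (hm : 1 < m) (hn : n ≠ 0) (hmn : m.Coprime n)
    (hr : IsUnit ((r : ZMod m) - 1))
    (ht : orderOf (r : ZMod m) * radical₀ (orderOf (r : ZMod m)) ∣ n) :
    ∃ H : GrpCat.{0}, Finite H ∧ IsZGroup H ∧ IsFrobeniusComplement H ∧
      Nat.card (commutator H) = m ∧ (commutator H).index = n ∧ HasCommutatorAction H r := by
  have : NeZero m := ⟨by omega⟩
  have : NeZero n := ⟨hn⟩
  have : Fact (1 < m) := ⟨hm⟩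
  obtain ⟨φ, hφ⟩ := exists_mulAut_pow (m := m) (r := r) hn
    (orderOf_dvd_iff_pow_eq_one.1 ((dvd_mul_right _ _).trans ht))
  have hfin : Finite (Multiplicative (ZMod m) ⋊[φ] Multiplicative (ZMod n)) :=
    Finite.of_equiv _ SemidirectProduct.equivProd.symm
  have hnt : Nontrivial (Multiplicative (ZMod m) ⋊[φ] Multiplicative (ZMod n)) :=
    SemidirectProduct.inl_injective.nontrivial
  have hcard : Nat.card (commutator (Multiplicative (ZMod m) ⋊[φ] Multiplicative (ZMod n))) = m := by
    rw [model_commutator hφ hr, ← Nat.card_congr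
      (MonoidHom.ofInjective SemidirectProduct.inl_injective).toEquiv]
    simp
  refine ⟨GrpCat.of (Multiplicative (ZMod m) ⋊[φ] Multiplicative (ZMod n)), hfin,
    model_isZGroup hmn, (model_hasFixedPointFreeAction hmn hφ ht).isFrobeniusComplement, hcard, ?_,
    model_hasCommutatorAction hφ hr⟩
  have h1 := (commutator (Multiplicative (ZMod m) ⋊[φ] Multiplicative (ZMod n))).card_mul_index
  rw [hcard, SemidirectProduct.card] at h1
  simp only [Nat.card_eq_fintype_card, Fintype.card_multiplicative, ZMod.card] at h1
  exact Nat.eq_of_mul_eq_mul_left (by omega) h1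

end Model

/-! ### Invariance under isomorphism -/

theorem MulEquiv.map_commutator_eq {H K : Type} [Group H] [Group K] (e : H ≃* K) :
    (commutator H).map e.toMonoidHom = commutator K := by
  rw [commutator_def, commutator_def, Subgroup.map_commutator,
    Subgroup.map_top_of_surjective _ e.surjective]

theorem MulEquiv.card_commutator_eq {H K : Type} [Group H] [Group K] (e : H ≃* K) :
    Nat.card (commutator H) = Nat.card (commutator K) := by
  rw [← e.map_commutator_eq]
  exact Nat.card_congr ((commutator H).equivMapOfInjective e.toMonoidHom e.injective).toEquiv

theorem MulEquiv.index_commutator_eq {H K : Type} [Group H] [Group K] (e : H ≃* K) :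
    (commutator H).index = (commutator K).index := by
  rw [← e.map_commutator_eq]
  exact (Subgroup.index_map_equiv _ e).symm

theorem HasCommutatorAction.of_mulEquiv {H K : Type} [Group H] [Group K] (e : H ≃* K) {r : ℕ}
    (h : HasCommutatorAction H r) : HasCommutatorAction K r := by
  obtain ⟨y, hy1, hy2⟩ := h
  refine ⟨e y, ?_, ?_⟩
  · have h1 := congrArg (Subgroup.map e.toMonoidHom) hy1
    rw [Subgroup.map_sup, e.map_commutator_eq, MonoidHom.map_zpowers,
      Subgroup.map_top_of_surjective _ e.surjective] at h1
    exact h1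
  · rw [← e.map_commutator_eq]
    rintro _ ⟨x, hx, rfl⟩
    have h1 := congrArg e (hy2 x hx)
    simpa using h1

theorem IsFrobeniusComplement.of_mulEquiv {H K : Type} [Group H] [Group K] (e : H ≃* K)
    (h : IsFrobeniusComplement H) : IsFrobeniusComplement K := by
  obtain ⟨G, _, L, hG, hL, ⟨f⟩⟩ := h
  exact ⟨G, inferInstance, L, hG, hL, ⟨e.symm.trans f⟩⟩

/-! ### Residues modulo a product of coprime integers -/

section Residues

variable {s : ℕ} {q : Fin s → ℕ}

theorem ZMod.prodEquivPi_natCast (hq : Pairwise (Function.onFun Nat.Coprime q)) (r : ℕ) :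
    ZMod.prodEquivPi q hq (r : ZMod (∏ i, q i)) = fun i => (r : ZMod (q i)) := by
  rw [map_natCast]; rfl

theorem natCast_eq_natCast_prod_iff (hq : Pairwise (Function.onFun Nat.Coprime q)) (a b : ℕ) :
    (a : ZMod (∏ i, q i)) = b ↔ ∀ i, (a : ZMod (q i)) = b := by
  rw [← (ZMod.prodEquivPi q hq).injective.eq_iff, ZMod.prodEquivPi_natCast,
    ZMod.prodEquivPi_natCast, funext_iff]

theorem orderOf_natCast_prod (hq : Pairwise (Function.onFun Nat.Coprime q)) (r : ℕ) :
    orderOf (r : ZMod (∏ i, q i)) = Finset.univ.lcm fun i => orderOf (r : ZMod (q i)) := by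
  rw [← Pi.orderOf (fun i => (r : ZMod (q i))), ← ZMod.prodEquivPi_natCast hq]
  exact ((ZMod.prodEquivPi q hq).toMulEquiv.orderOf_eq _).symm

theorem isUnit_natCast_prod_sub_one_iff (hq : Pairwise (Function.onFun Nat.Coprime q)) (r : ℕ) :
    IsUnit ((r : ZMod (∏ i, q i)) - 1) ↔ ∀ i, IsUnit ((r : ZMod (q i)) - 1) := by
  rw [← isUnit_map_iff (ZMod.prodEquivPi q hq), map_sub, map_one, ZMod.prodEquivPi_natCast,
    Pi.isUnit_iff]
  rfl

theorem exists_natCast_eq (hq : Pairwise (Function.onFun Nat.Coprime q)) (hq0 : ∀ i, q i ≠ 0)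
    (f : ∀ i, ZMod (q i)) : ∃ r : ℕ, ∀ i, (r : ZMod (q i)) = f i := by
  have : NeZero (∏ i, q i) := ⟨Finset.prod_ne_zero_iff.2 fun i _ => hq0 i⟩
  obtain ⟨r, hr⟩ := ZMod.natCast_zmod_surjective ((ZMod.prodEquivPi q hq).symm f)
  refine ⟨r, fun i => ?_⟩
  have h1 := congrArg (ZMod.prodEquivPi q hq) hr
  rw [ZMod.prodEquivPi_natCast, RingEquiv.apply_symm_apply] at h1
  exact congrFun h1 i

/-- Modulo a prime power, a nontrivial element of order prime to the characteristic
differs from `1` by a unit. -/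
theorem isUnit_sub_one_of_coprime_orderOf {p a : ℕ} (hp : p.Prime) (x : ZMod (p ^ a))
    (hx : ¬ p ∣ orderOf x) (hx1 : orderOf x ≠ 1) : IsUnit (x - 1) := by
  rcases a with - | a
  · have : Subsingleton (ZMod (p ^ 0)) := by rw [pow_zero]; infer_instance
    exact isUnit_of_subsingleton _
  have : NeZero (p ^ (a + 1)) := ⟨pow_ne_zero _ hp.ne_zero⟩
  by_contra hcon
  obtain ⟨y, hy⟩ := ZMod.natCast_zmod_surjective (x - 1)
  rw [← hy, ZMod.isUnit_iff_coprime, Nat.coprime_pow_right_iff (Nat.succ_pos a),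
    Nat.coprime_comm, hp.coprime_iff_not_dvd, not_not] at hcon
  have h1 : (p : ZMod (p ^ (a + 1))) ∣ x - 1 := by
    rw [← hy]
    exact_mod_cast Nat.cast_dvd_cast (α := ZMod (p ^ (a + 1))) hcon
  -- If `p ∣ x - 1`, then `x ^ p ^ a = 1` modulo `p ^ (a + 1)`, so the order of `x` is a power of
  -- `p`.
  have h2 := dvd_sub_pow_of_dvd_sub h1 a
  rw [← Nat.cast_pow, ZMod.natCast_self, zero_dvd_iff, one_pow, sub_eq_zero] at h2
  obtain ⟨j, -, hj⟩ := (Nat.dvd_prime_pow hp).1 (orderOf_dvd_of_pow_eq_one h2)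
  rcases j with - | j
  · exact hx1 (by simpa using hj)
  · exact hx (hj ▸ dvd_pow_self p (Nat.succ_ne_zero j))

end Residues

theorem radical₀_dvd (t : ℕ) : radical₀ t ∣ t := Nat.prod_primeFactors_dvd t

/-- An integer prime to a divisor of `n` can be changed by multiples of the divisor to become prime
to `n`. -/
theorem exists_coprime_modEq {n t j : ℕ} (hn : n ≠ 0) (ht : t ∣ n) (hj : j.Coprime t) :
    ∃ j' : ℕ, j'.Coprime n ∧ j' ≡ j [MOD t] := by
  have : NeZero n := ⟨hn⟩
  obtain ⟨u, hu⟩ := ZMod.unitsMap_surjective ht (ZMod.unitOfCoprime j hj)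
  refine ⟨(u : ZMod n).val, ZMod.val_coe_unit_coprime u, ?_⟩
  have h1 := congrArg Units.val hu
  rw [ZMod.unitsMap_val, ZMod.coe_unitOfCoprime] at h1
  rw [← ZMod.natCast_eq_natCast_iff, ← h1, ← ZMod.natCast_val]

/-- In a finite group, the elements of the form `f ^ j` having the same order as `f` are counted by
Euler's function. -/
theorem card_powers_of_orderOf_eq {G : Type} [Group G] [Finite G] (f : G) (S : Finset G)
    (hS : ∀ g, g ∈ S ↔ orderOf g = orderOf f ∧ ∃ j : ℕ, g = f ^ j) :
    S.card = (orderOf f).totient := by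
  rw [Nat.totient_eq_card_coprime, eq_comm]
  have hpos := orderOf_pos f
  refine Finset.card_bij (fun j _ => f ^ j) ?_ ?_ ?_
  · intro j hj
    exact (hS _).2 ⟨(Finset.mem_filter.1 hj).2.orderOf_pow, j, rfl⟩
  · intro i hi j hj hij
    simp only [Finset.mem_filter, Finset.mem_range] at hi hj
    exact pow_injOn_Iio_orderOf hi.1 hj.1 hij
  · intro g hg
    obtain ⟨hord, j, rfl⟩ := (hS g).1 hg
    refine ⟨j % orderOf f, ?_, pow_mod_orderOf f j⟩
    simp only [Finset.mem_filter, Finset.mem_range]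
    refine ⟨Nat.mod_lt _ hpos, ?_⟩
    rw [orderOf_pow] at hord
    have h1 : (orderOf f).gcd j = 1 := by
      have h2 := Nat.div_mul_cancel (Nat.gcd_dvd_left (orderOf f) j)
      rw [hord] at h2
      exact Nat.eq_of_mul_eq_mul_left hpos (by rw [h2, mul_one])
    rw [Nat.coprime_iff_gcd_eq_one, Nat.gcd_comm, ← Nat.gcd_rec, h1]

/-! ### Complements realizing a tuple -/

section Tuples

variable {s : ℕ}

/-- `(τ, k)` satisfies the conditions (1), (2), and `pⱼ ∤ k`. -/
def IsValidPair (τ : Fin s → ℕ × ℕ) (k : ℕ) : Prop :=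
  CountTuple.IsTuple τ ∧ CountTuple.Cond1 τ ∧ CountTuple.Cond2 τ ∧ 0 < k ∧
    ∀ j, ¬ CountTuple.p τ j ∣ k

/-- `H` is a Sylow-cyclic Frobenius complement with invariants `(τ, k)`. -/
def Realizes (H : GrpCat.{0}) (τ : Fin s → ℕ × ℕ) (k : ℕ) : Prop :=
  Finite H ∧ IsZGroup H ∧ IsFrobeniusComplement H ∧ Nat.card (commutator H) = CountTuple.m τ ∧
    (commutator H).index = CountTuple.lcm τ * radical₀ (CountTuple.lcm τ) * k ∧
    ∃ r, HasCommutatorAction H r ∧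
      ∀ i, orderOf (r : ZMod (CountTuple.q τ i)) = CountTuple.t τ i

/-- The isomorphism classes of the groups that realize `(τ, k)`. -/
def realizedClasses (τ : Fin s → ℕ × ℕ) (k : ℕ) : Set (Quotient groupIsoSetoid) :=
  Quotient.mk groupIsoSetoid '' {H | Realizes H τ k}

theorem Realizes.of_mulEquiv {H K : GrpCat.{0}} {τ : Fin s → ℕ × ℕ} {k : ℕ} (e : H ≃* K)
    (h : Realizes H τ k) : Realizes K τ k := by
  obtain ⟨hfin, hZ, hF, hm, hn, r, hr, ht⟩ := h
  exact ⟨Finite.of_equiv H e.toEquiv, IsZGroup.of_injective (f := e.symm.toMonoidHom)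
    e.symm.injective, hF.of_mulEquiv e, e.card_commutator_eq ▸ hm, e.index_commutator_eq ▸ hn,
    r, hr.of_mulEquiv e, ht⟩

theorem mk_mem_realizedClasses_iff {H : GrpCat.{0}} {τ : Fin s → ℕ × ℕ} {k : ℕ} :
    Quotient.mk groupIsoSetoid H ∈ realizedClasses τ k ↔ Realizes H τ k := by
  constructor
  · rintro ⟨K, hK, hKH⟩
    obtain ⟨e⟩ := Quotient.exact hKH
    exact hK.of_mulEquiv e
  · exact fun h => ⟨H, h, rfl⟩

variable {τ : Fin s → ℕ × ℕ} {k : ℕ}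

theorem IsValidPair.p_prime (h : IsValidPair τ k) (i : Fin s) : (CountTuple.p τ i).Prime :=
  Nat.minFac_prime (h.1 i).1.ne_one

theorem IsValidPair.exists_q_eq (h : IsValidPair τ k) (i : Fin s) :
    ∃ a, CountTuple.q τ i = CountTuple.p τ i ^ (a + 1) := by
  have h1 := (h.1 i).1.minFac_pow_factorization_eq
  have h2 : (CountTuple.q τ i).factorization (CountTuple.q τ i).minFac ≠ 0 := by
    intro h0
    rw [h0, pow_zero] at h1
    exact (h.1 i).1.ne_one h1.symm
  obtain ⟨a, ha⟩ := Nat.exists_eq_succ_of_ne_zero h2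
  exact ⟨a, by rw [ha] at h1; exact h1.symm⟩

theorem IsValidPair.coprime_q (h : IsValidPair τ k) :
    Pairwise (Function.onFun Nat.Coprime (CountTuple.q τ)) := by
  intro i j hij
  obtain ⟨a, ha⟩ := h.exists_q_eq i
  obtain ⟨b, hb⟩ := h.exists_q_eq j
  rw [Function.onFun, ha, hb]
  exact Nat.Coprime.pow _ _ (((Nat.coprime_primes (h.p_prime i) (h.p_prime j))).2
    ((h.2.2.1 i j).2 hij))

theorem IsValidPair.not_dvd_lcm (h : IsValidPair τ k) (j : Fin s) :
    ¬ CountTuple.p τ j ∣ CountTuple.lcm τ := by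
  intro hdvd
  have h1 : CountTuple.lcm τ ∣ ∏ i, CountTuple.t τ i :=
    Finset.lcm_dvd fun i _ => Finset.dvd_prod_of_mem _ (Finset.mem_univ i)
  obtain ⟨i, -, hi⟩ := (h.p_prime j).prime.exists_mem_finset_dvd (hdvd.trans h1)
  exact (h.2.2.1 i j).1 hi

theorem IsValidPair.coprime (h : IsValidPair τ k) :
    (CountTuple.m τ).Coprime (CountTuple.lcm τ * radical₀ (CountTuple.lcm τ) * k) := by
  rw [CountTuple.m, Nat.coprime_prod_left_iff]
  intro j _
  obtain ⟨a, ha⟩ := h.exists_q_eq j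
  rw [ha]
  apply Nat.Coprime.pow_left
  rw [(h.p_prime j).coprime_iff_not_dvd, (h.p_prime j).dvd_mul, (h.p_prime j).dvd_mul]
  rintro ((h1 | h1) | h1)
  · exact h.not_dvd_lcm j h1
  · exact h.not_dvd_lcm j (h1.trans (radical₀_dvd _))
  · exact h.2.2.2.2 j h1

theorem IsValidPair.one_lt_m (h : IsValidPair τ k) (hs : 1 ≤ s) : 1 < CountTuple.m τ := by
  have hpos : 0 < CountTuple.m τ := Finset.prod_pos fun j _ => (h.1 j).1.pos
  exact (h.1 ⟨0, hs⟩).1.one_lt.trans_le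
    (Nat.le_of_dvd hpos (Finset.dvd_prod_of_mem _ (Finset.mem_univ _)))

theorem IsValidPair.t_dvd (h : IsValidPair τ k) (i : Fin s) :
    CountTuple.t τ i ∣ CountTuple.p τ i - 1 :=
  (Nat.modEq_iff_dvd' (h.p_prime i).one_lt.le).1 (h.2.1 i).2.symm

-- Since `tᵢ > 1` divides `pᵢ - 1`, the prime `pᵢ` is odd and the units modulo `pᵢ^aᵢ` form a cyclic
-- group of order divisible by `tᵢ`.
open Classical in
theorem IsValidPair.card_orderOf_eq (h : IsValidPair τ k) (i : Fin s)
    [Fintype (ZMod (CountTuple.q τ i))ˣ] :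
    (Finset.univ.filter fun u : (ZMod (CountTuple.q τ i))ˣ =>
      orderOf u = CountTuple.t τ i).card = (CountTuple.t τ i).totient := by
  have hp := h.p_prime i
  have hp2 : CountTuple.p τ i ≠ 2 := by
    intro h2
    have h3 := h.t_dvd i
    rw [h2] at h3
    exact (h.2.1 i).1.ne' (Nat.dvd_one.1 h3)
  have : NeZero (CountTuple.q τ i) := ⟨(h.1 i).1.ne_zero⟩
  obtain ⟨a, ha⟩ := h.exists_q_eq i
  have hcyc : IsCyclic (ZMod (CountTuple.q τ i))ˣ := by
    rw [ha]; exact ZMod.isCyclic_units_of_prime_pow _ hp hp2 _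
  apply IsCyclic.card_orderOf_eq_totient
  rw [ZMod.card_units_eq_totient, ha, Nat.totient_prime_pow hp (Nat.succ_pos a)]
  exact (h.t_dvd i).mul_left _

/-- As `tᵢ > 1` is prime to `pᵢ`, `r - 1` is a unit modulo each prime power, hence modulo `m`. -/
theorem IsValidPair.exists_realizes (h : IsValidPair τ k) (hs : 1 ≤ s) {r : ℕ}
    (hr : ∀ i, orderOf (r : ZMod (CountTuple.q τ i)) = CountTuple.t τ i) :
    ∃ H : GrpCat.{0}, Realizes H τ k ∧ HasCommutatorAction H r := by
  have hord : orderOf (r : ZMod (CountTuple.m τ)) = CountTuple.lcm τ := by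
    rw [CountTuple.m, orderOf_natCast_prod h.coprime_q]
    exact Finset.lcm_congr rfl fun i _ => hr i
  have hunit : IsUnit ((r : ZMod (CountTuple.m τ)) - 1) := by
    rw [CountTuple.m, isUnit_natCast_prod_sub_one_iff h.coprime_q]
    intro i
    obtain ⟨a, ha⟩ := h.exists_q_eq i
    have h1 := hr i
    rw [ha] at h1 ⊢
    refine isUnit_sub_one_of_coprime_orderOf (h.p_prime i) _ ?_ ?_
    · rw [h1]; exact (h.2.2.1 i i).1
    · rw [h1]; exact (h.2.1 i).1.ne'
  have hn : CountTuple.lcm τ * radical₀ (CountTuple.lcm τ) * k ≠ 0 :=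
    mul_ne_zero (mul_ne_zero (CountTuple.lcm_pos h.1).ne' (radical₀_pos _).ne') h.2.2.2.1.ne'
  obtain ⟨H, hfin, hZ, hF, hm, hn, hact⟩ := exists_complement (h.one_lt_m hs) hn h.coprime hunit
    (by rw [hord]; exact dvd_mul_right _ _)
  exact ⟨H, ⟨hfin, hZ, hF, hm, hn, r, hact, hr⟩, hact⟩

/-- The number of isomorphism classes that realize `(τ, k)`. -/
theorem IsValidPair.ncard_realizedClasses (h : IsValidPair τ k) (hs : 1 ≤ s) :
    (realizedClasses τ k).ncard * (CountTuple.lcm τ).totient =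
      ∏ i, (CountTuple.t τ i).totient := by
  classical
  have hq0 : ∀ i, CountTuple.q τ i ≠ 0 := fun i => (h.1 i).1.ne_zero
  have : ∀ i, NeZero (CountTuple.q τ i) := fun i => ⟨hq0 i⟩
  -- By the Chinese remainder theorem, these families are the admissible residues `r` modulo `m`.
  let F : Finset (∀ i, (ZMod (CountTuple.q τ i))ˣ) := Fintype.piFinset fun i =>
    Finset.univ.filter fun u : (ZMod (CountTuple.q τ i))ˣ => orderOf u = CountTuple.t τ i
  have hF : ∀ f, f ∈ F ↔ ∀ i, orderOf (f i) = CountTuple.t τ i := by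
    intro f
    simp [F]
  have hFcard : F.card = ∏ i, (CountTuple.t τ i).totient := by
    rw [Fintype.card_piFinset]
    exact Finset.prod_congr rfl fun i _ => h.card_orderOf_eq i
  have hForder : ∀ f ∈ F, orderOf f = CountTuple.lcm τ := by
    intro f hf
    rw [Pi.orderOf]
    exact Finset.lcm_congr rfl fun i _ => (hF f).1 hf i
  choose r hr using fun f : ∀ i, (ZMod (CountTuple.q τ i))ˣ =>
    exists_natCast_eq h.coprime_q hq0 fun i => (f i : ZMod (CountTuple.q τ i))
  have hrord : ∀ f ∈ F, ∀ i, orderOf (r f : ZMod (CountTuple.q τ i)) = CountTuple.t τ i := by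
    intro f hf i
    rw [hr, orderOf_units]
    exact (hF f).1 hf i
  choose! K hK hKr using fun f (hf : f ∈ F) => h.exists_realizes hs (hrord f hf)
  let Φ : (∀ i, (ZMod (CountTuple.q τ i))ˣ) → Quotient groupIsoSetoid := fun f =>
    Quotient.mk groupIsoSetoid (K f)
  have hcong : ∀ (f : ∀ i, (ZMod (CountTuple.q τ i))ˣ) (a : ℕ),
      (∀ i, (a : ZMod (CountTuple.q τ i)) = f i) →
        (a : ZMod (CountTuple.m τ)) = r f := by
    intro f a ha
    rw [CountTuple.m, natCast_eq_natCast_prod_iff h.coprime_q]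
    intro i
    rw [ha, hr]
  have hiso : ∀ f ∈ F, ∀ H : GrpCat.{0}, Realizes H τ k → HasCommutatorAction H (r f) →
      Φ f = Quotient.mk groupIsoSetoid H := by
    intro f hf H hH hact
    obtain ⟨_, _, -, hm, hn, -⟩ := hH
    obtain ⟨_, _, -, hm', hn', -⟩ := hK f hf
    exact Quotient.sound ((hKr f hf).nonempty_mulEquiv hact (hm'.trans hm.symm)
      (hn'.trans hn.symm))
  have himage : realizedClasses τ k = (F.image Φ : Set (Quotient groupIsoSetoid)) := by
    ext c
    simp only [Finset.coe_image, Set.mem_image, Finset.mem_coe]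
    constructor
    · rintro ⟨H, hH, rfl⟩
      obtain ⟨hfin, hZ, hFC, hm, hn, a, ha, hord⟩ := id hH
      have hunit : ∀ i, IsUnit (a : ZMod (CountTuple.q τ i)) := by
        intro i
        refine IsUnit.of_pow_eq_one (pow_orderOf_eq_one _) ?_
        rw [hord]
        exact (h.1 i).2.ne'
      have hf : (fun i => (hunit i).unit) ∈ F := by
        rw [hF]
        intro i
        rw [← orderOf_units, IsUnit.unit_spec, hord]
      exact ⟨_, hf, hiso _ hf H hH (ha.congr (hm ▸ hcong _ a fun i => rfl))⟩
    · rintro ⟨f, hf, rfl⟩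
      exact ⟨K f, hK f hf, rfl⟩
  -- Two families give isomorphic groups exactly when they generate the same cyclic group, of order
  -- `t`.
  have hfiber : ∀ f ∈ F, (F.filter fun g => Φ g = Φ f).card = (CountTuple.lcm τ).totient := by
    intro f hf
    rw [← hForder f hf]
    apply card_powers_of_orderOf_eq
    intro g
    rw [Finset.mem_filter]
    obtain ⟨_, _, -, hm, hn, -⟩ := id (hK f hf)
    constructor
    · rintro ⟨hg, hgf⟩
      refine ⟨by rw [hForder g hg, hForder f hf], ?_⟩
      obtain ⟨e⟩ := Quotient.exact hgf
      obtain ⟨j, hj⟩ := (hKr f hf).exists_eq_pow ((hKr g hg).of_mulEquiv e)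
      rw [hm, ← Nat.cast_pow, CountTuple.m, natCast_eq_natCast_prod_iff h.coprime_q] at hj
      refine ⟨j, funext fun i => Units.ext ?_⟩
      have := hj i
      rw [Nat.cast_pow, hr, hr] at this
      simpa using this
    · rintro ⟨hord, j, rfl⟩
      have hjt : j.Coprime (CountTuple.lcm τ) := by
        have hpos := orderOf_pos f
        rw [orderOf_pow] at hord
        have h2 := Nat.div_mul_cancel (Nat.gcd_dvd_left (orderOf f) j)
        rw [hord] at h2
        rw [Nat.coprime_comm, ← hForder f hf]
        exact Nat.eq_of_mul_eq_mul_left hpos (by rw [h2, mul_one])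
      have hg : f ^ j ∈ F := by
        rw [hF]
        intro i
        rw [Pi.pow_apply, Nat.Coprime.orderOf_pow, (hF f).1 hf i]
        rw [(hF f).1 hf i, Nat.coprime_comm]
        exact hjt.of_dvd_right (Finset.dvd_lcm (Finset.mem_univ i))
      -- Only `j` modulo `t` matters for the action; it is changed to be prime to the index so that
      -- `y ^ j'` still generates modulo the commutator subgroup.
      obtain ⟨j', hj'n, hj't⟩ := exists_coprime_modEq (Subgroup.index_ne_zero_of_finite
        (H := commutator (K f))) (hn ▸ (dvd_mul_right _ _).mul_right _) hjt
      refine ⟨hg, hiso _ hg _ (hK f hf) ?_⟩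
      obtain ⟨y, hy⟩ := hKr f hf
      refine HasCommutatorAction.congr ⟨_, hy.pow hj'n⟩ (hm ▸ hcong _ _ fun i => ?_)
      rw [Nat.cast_pow, hr, Pi.pow_apply, ← Units.val_pow_eq_pow_val, Units.val_inj,
        pow_eq_pow_iff_modEq, (hF f).1 hf i]
      exact hj't.of_dvd (Finset.dvd_lcm (Finset.mem_univ i))
  rw [himage, Set.ncard_coe_finset, ← hFcard, Finset.card_eq_sum_card_image Φ F,
    ← smul_eq_mul, ← Finset.sum_const]
  refine Finset.sum_congr rfl fun c hc => ?_
  obtain ⟨f, hf, rfl⟩ := Finset.mem_image.1 hc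
  exact (hfiber f hf).symm

end Tuples

/-! ### The tuples realized by a given group -/

section Orderings

variable {s : ℕ}

/-- The tuple that belongs to an ordering of the prime factors of `m` and to an integer `r`. -/
noncomputable def tupleOfOrdering {m : ℕ} (r : ℕ) (e : Fin s ≃ m.primeFactors) :
    Fin s → ℕ × ℕ :=
  fun i => ((e i : ℕ) ^ m.factorization (e i),
    orderOf (r : ZMod ((e i : ℕ) ^ m.factorization (e i))))

variable {m r : ℕ} (e : Fin s ≃ m.primeFactors)

theorem factorization_ne_zero_of_mem (x : m.primeFactors) : m.factorization x ≠ 0 := by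
  rw [← Finsupp.mem_support_iff, Nat.support_factorization]
  exact x.2

theorem p_tupleOfOrdering (i : Fin s) : CountTuple.p (tupleOfOrdering r e) i = e i :=
  (Nat.prime_of_mem_primeFactors (e i).2).pow_minFac (factorization_ne_zero_of_mem (e i))

theorem m_tupleOfOrdering (hm : m ≠ 0) : CountTuple.m (tupleOfOrdering r e) = m := by
  have h1 : ∏ i, (e i : ℕ) ^ m.factorization (e i) =
      ∏ x : m.primeFactors, (x : ℕ) ^ m.factorization x :=
    e.prod_comp fun x : m.primeFactors => (x : ℕ) ^ m.factorization x
  calc CountTuple.m (tupleOfOrdering r e) = ∏ i, (e i : ℕ) ^ m.factorization (e i) := rfl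
    _ = ∏ x ∈ m.primeFactors, x ^ m.factorization x := by
      rw [h1]
      exact Finset.prod_coe_sort m.primeFactors fun x => x ^ m.factorization x
    _ = m := Nat.prod_factorization_pow_eq_self hm

theorem coprime_tupleOfOrdering :
    Pairwise (Function.onFun Nat.Coprime (CountTuple.q (tupleOfOrdering r e))) := by
  intro i j hij
  refine Nat.Coprime.pow _ _ ((Nat.coprime_primes (Nat.prime_of_mem_primeFactors (e i).2)
    (Nat.prime_of_mem_primeFactors (e j).2)).2 ?_)
  exact fun h => hij (e.injective (Subtype.ext h))

theorem lcm_tupleOfOrdering (hm : m ≠ 0) :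
    CountTuple.lcm (tupleOfOrdering r e) = orderOf (r : ZMod m) := by
  have h1 := orderOf_natCast_prod (coprime_tupleOfOrdering (r := r) e) r
  change orderOf (r : ZMod (CountTuple.m (tupleOfOrdering r e))) = _ at h1
  rw [m_tupleOfOrdering e hm] at h1
  exact h1.symm

theorem orderOf_natCast_dvd_of_eq_pow {m q a b j : ℕ} (hq : q ∣ m)
    (h : (b : ZMod m) = (a : ZMod m) ^ j) : orderOf (b : ZMod q) ∣ orderOf (a : ZMod q) := by
  have h1 : (b : ZMod q) = (a : ZMod q) ^ j := by
    have := congrArg (ZMod.castHom hq (ZMod q)) h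
    rwa [map_pow, map_natCast, map_natCast] at this
  rw [h1]
  exact orderOf_pow_dvd j

theorem IsValidPair.primeFactors_m {τ : Fin s → ℕ × ℕ} {k : ℕ} (h : IsValidPair τ k) :
    (CountTuple.m τ).primeFactors = Finset.univ.image (CountTuple.p τ) := by
  have hm0 : CountTuple.m τ ≠ 0 := Finset.prod_ne_zero_iff.2 fun i _ => (h.1 i).1.ne_zero
  ext x
  simp only [Finset.mem_univ, true_and, Finset.mem_image]
  constructor
  · intro hx
    have hxp := Nat.prime_of_mem_primeFactors hx
    obtain ⟨i, -, hi⟩ := hxp.prime.exists_mem_finset_dvd (Nat.dvd_of_mem_primeFactors hx)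
    obtain ⟨a, ha⟩ := h.exists_q_eq i
    rw [ha] at hi
    exact ⟨i, ((Nat.prime_dvd_prime_iff_eq hxp (h.p_prime i)).1 (hxp.dvd_of_dvd_pow hi)).symm⟩
  · rintro ⟨i, rfl⟩
    exact Nat.mem_primeFactors.2 ⟨h.p_prime i, (Nat.minFac_dvd _).trans
      (Finset.dvd_prod_of_mem (CountTuple.q τ) (Finset.mem_univ i)), hm0⟩

theorem IsValidPair.p_injective {τ : Fin s → ℕ × ℕ} {k : ℕ} (h : IsValidPair τ k) :
    Function.Injective (CountTuple.p τ) := by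
  intro i j hij
  by_contra hne
  exact (h.2.2.1 i j).2 hne hij

theorem IsValidPair.card_primeFactors_m {τ : Fin s → ℕ × ℕ} {k : ℕ} (h : IsValidPair τ k) :
    (CountTuple.m τ).primeFactors.card = s := by
  rw [h.primeFactors_m, Finset.card_image_of_injective _ h.p_injective, Finset.card_univ,
    Fintype.card_fin]

theorem IsValidPair.q_eq {τ : Fin s → ℕ × ℕ} {k : ℕ} (h : IsValidPair τ k) (i : Fin s) :
    CountTuple.q τ i = CountTuple.p τ i ^ (CountTuple.m τ).factorization (CountTuple.p τ i) := by
  obtain ⟨a, ha⟩ := h.exists_q_eq i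
  have h1 : (CountTuple.m τ).factorization (CountTuple.p τ i) = a + 1 := by
    rw [CountTuple.m, Nat.factorization_prod fun i _ => (h.1 i).1.ne_zero, Finset.sum_apply',
      Finset.sum_eq_single i]
    · rw [ha, (h.p_prime i).factorization_pow, Finsupp.single_eq_same]
    · intro j _ hji
      obtain ⟨b, hb⟩ := h.exists_q_eq j
      rw [hb, (h.p_prime j).factorization_pow, Finsupp.single_apply, if_neg]
      exact fun hp => hji (h.p_injective hp)
    · intro hi
      exact absurd (Finset.mem_univ i) hi
  rw [h1, ha]

/-- Each `tᵢ` divides the index, which is prime to every `pⱼ`. As `tᵢ` also divides `φ(pᵢ^aᵢ) =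
pᵢ^(aᵢ-1) (pᵢ - 1)`, it divides `pᵢ - 1`. It exceeds `1` because `r - 1` is a unit modulo `pᵢ^aᵢ`.
-/
theorem isValidPair_tupleOfOrdering {H : Type} [Group H] [Finite H] [IsZGroup H]
    (hr : HasCommutatorAction H r)
    (e : Fin s ≃ (Nat.card (commutator H)).primeFactors) {k : ℕ}
    (hk : (commutator H).index = CountTuple.lcm (tupleOfOrdering r e) *
      radical₀ (CountTuple.lcm (tupleOfOrdering r e)) * k) :
    IsValidPair (tupleOfOrdering r e) k := by
  have hm0 : Nat.card (commutator H) ≠ 0 := Nat.card_pos.ne'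
  have hn0 : (commutator H).index ≠ 0 := Subgroup.index_ne_zero_of_finite
  have hcop := IsZGroup.coprime_commutator_index (G := H)
  obtain ⟨y, hy⟩ := hr
  have hlcm := lcm_tupleOfOrdering (r := r) e hm0
  have hdvd : CountTuple.lcm (tupleOfOrdering r e) ∣ (commutator H).index :=
    hlcm ▸ hy.orderOf_dvd
  have htdvd : ∀ i, CountTuple.t (tupleOfOrdering r e) i ∣ (commutator H).index := fun i =>
    (Finset.dvd_lcm (Finset.mem_univ i)).trans hdvd
  have hpdvd : ∀ i, (e i : ℕ) ∣ Nat.card (commutator H) := fun i =>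
    Nat.dvd_of_mem_primeFactors (e i).2
  have hpp : ∀ i, (e i : ℕ).Prime := fun i => Nat.prime_of_mem_primeFactors (e i).2
  have hnot : ∀ i x, x ∣ (commutator H).index → ¬ (e i : ℕ) ∣ x := fun i x hx hd =>
    (hpp i).one_lt.ne' (Nat.eq_one_of_dvd_coprimes hcop (hpdvd i) (hd.trans hx))
  have htpos : ∀ i, 0 < CountTuple.t (tupleOfOrdering r e) i := fun i =>
    Nat.pos_of_dvd_of_pos (htdvd i) (Nat.pos_of_ne_zero hn0)
  refine ⟨fun i => ⟨(hpp i).isPrimePow.pow (factorization_ne_zero_of_mem (e i)), htpos i⟩,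
    fun i => ⟨?_, ?_⟩, fun i j => ⟨?_, ?_⟩, ?_, fun j => ?_⟩
  · have h1 : ∀ m, m = Nat.card (commutator H) → IsUnit ((r : ZMod m) - 1) := by
      rintro _ rfl
      exact hy.isUnit_sub_one
    have h2 := (isUnit_natCast_prod_sub_one_iff (coprime_tupleOfOrdering e) r).1
      (h1 _ (m_tupleOfOrdering (r := r) e hm0)) i
    refine lt_of_le_of_ne (htpos i) fun h3 => ?_
    have h4 : (r : ZMod (CountTuple.q (tupleOfOrdering r e) i)) = 1 :=
      orderOf_eq_one_iff.1 h3.symm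
    rw [h4, sub_self] at h2
    have h5 : 1 < CountTuple.q (tupleOfOrdering r e) i :=
      Nat.one_lt_pow (factorization_ne_zero_of_mem (e i)) (hpp i).one_lt
    have : Fact (1 < CountTuple.q (tupleOfOrdering r e) i) := ⟨h5⟩
    exact not_isUnit_zero h2
  · rw [p_tupleOfOrdering, Nat.ModEq.comm, Nat.modEq_iff_dvd' (hpp i).one_lt.le]
    obtain ⟨a, ha⟩ := Nat.exists_eq_succ_of_ne_zero (factorization_ne_zero_of_mem (e i))
    have h1 : CountTuple.t (tupleOfOrdering r e) i ∣
        ((e i : ℕ) ^ (Nat.card (commutator H)).factorization (e i)).totient := by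
      have hu : IsUnit (r : ZMod ((e i : ℕ) ^ (Nat.card (commutator H)).factorization (e i))) :=
        IsUnit.of_pow_eq_one (pow_orderOf_eq_one _) (htpos i).ne'
      have : NeZero ((e i : ℕ) ^ (Nat.card (commutator H)).factorization (e i)) :=
        ⟨pow_ne_zero _ (hpp i).ne_zero⟩
      rw [← ZMod.card_units_eq_totient]
      change orderOf (r : ZMod ((e i : ℕ) ^ (Nat.card (commutator H)).factorization (e i))) ∣ _
      rw [← hu.unit_spec, orderOf_units]
      exact orderOf_dvd_card
    rw [ha, Nat.totient_prime_pow_succ (hpp i)] at h1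
    refine Nat.Coprime.dvd_of_dvd_mul_left ?_ h1
    apply Nat.Coprime.pow_right
    rw [Nat.coprime_comm, (hpp i).coprime_iff_not_dvd]
    exact hnot i _ (htdvd i)
  · rw [p_tupleOfOrdering]
    exact hnot j _ (htdvd i)
  · intro hij h
    rw [p_tupleOfOrdering, p_tupleOfOrdering] at h
    exact hij (e.injective (Subtype.ext h))
  · refine Nat.pos_of_ne_zero fun h0 => hn0 ?_
    rw [hk, h0, mul_zero]
  · rw [p_tupleOfOrdering]
    exact hnot j _ (hk ▸ dvd_mul_left _ _)

/-- A Sylow-cyclic Frobenius complement of breadth `s` realizes exactly `s!` pairs `(τ, k)`. -/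
theorem ncard_realized_pairs {H : GrpCat.{0}} [Finite H] [IsZGroup H]
    (hF : IsFrobeniusComplement H) (hb : breadth H = s) :
    {x : (Fin s → ℕ × ℕ) × ℕ | IsValidPair x.1 x.2 ∧ Realizes H x.1 x.2}.ncard =
      s.factorial := by
  classical
  have hfpf := hF.hasFixedPointFreeAction
  obtain ⟨r, hr⟩ := IsZGroup.exists_hasCommutatorAction H
  have hm0 : Nat.card (commutator H) ≠ 0 := Nat.card_pos.ne'
  have hdvd := hfpf.orderOf_mul_radical_dvd hr
  set m := Nat.card (commutator H) with hm
  -- The index forces `k`, so only the ordering of the primes remains free.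
  let kk := (commutator H).index / (orderOf (r : ZMod m) * radical₀ (orderOf (r : ZMod m)))
  let Ψ : (Fin s ≃ m.primeFactors) → (Fin s → ℕ × ℕ) × ℕ := fun e => (tupleOfOrdering r e, kk)
  have hΨ : Function.Injective Ψ := by
    intro e f hef
    ext i
    rw [← p_tupleOfOrdering (r := r) e i, ← p_tupleOfOrdering (r := r) f i]
    exact congrArg (fun τ => CountTuple.p τ i) (congrArg Prod.fst hef)
  have hrange : {x : (Fin s → ℕ × ℕ) × ℕ | IsValidPair x.1 x.2 ∧ Realizes H x.1 x.2} =
      Ψ '' Set.univ := by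
    ext ⟨τ, k⟩
    simp only [Set.mem_ofPred_eq, Set.image_univ, Set.mem_range]
    constructor
    · rintro ⟨hv, -, -, -, hmτ, hn, r', hr', ht⟩
      rw [← hm] at hmτ
      have hmem : ∀ i, CountTuple.p τ i ∈ m.primeFactors := by
        intro i
        rw [hmτ, hv.primeFactors_m]
        exact Finset.mem_image_of_mem _ (Finset.mem_univ i)
      let e : Fin s ≃ m.primeFactors := Equiv.ofBijective (fun i => ⟨CountTuple.p τ i, hmem i⟩) (by
        rw [Fintype.bijective_iff_injective_and_card]
        refine ⟨fun i j hij => hv.p_injective (congrArg Subtype.val hij), ?_⟩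
        rw [Fintype.card_fin, Fintype.card_coe]
        exact hb.symm)
      have hq : ∀ i, CountTuple.q τ i = (e i : ℕ) ^ m.factorization (e i) := by
        intro i
        rw [hv.q_eq i, ← hmτ]
        rfl
      have hτ : tupleOfOrdering r e = τ := by
        funext i
        refine Prod.ext (hq i).symm ?_
        change orderOf (r : ZMod ((e i : ℕ) ^ m.factorization (e i))) = CountTuple.t τ i
        rw [← hq i, ← ht i]
        have hqm : CountTuple.q τ i ∣ m := hmτ ▸ Finset.dvd_prod_of_mem _ (Finset.mem_univ i)
        -- Each of `r` and `r'` is a power of the other modulo `m`, so their orders modulo every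
        -- `pᵢ^aᵢ` agree.
        obtain ⟨j, hj⟩ := hr.exists_eq_pow hr'
        obtain ⟨j', hj'⟩ := hr'.exists_eq_pow hr
        exact Nat.dvd_antisymm (orderOf_natCast_dvd_of_eq_pow hqm hj')
          (orderOf_natCast_dvd_of_eq_pow hqm hj)
      refine ⟨e, Prod.ext hτ ?_⟩
      have hlcm := lcm_tupleOfOrdering (r := r) e hm0
      rw [hτ] at hlcm
      change (commutator H).index / _ = k
      rw [hn, hlcm]
      refine Nat.mul_div_cancel_left _ (mul_pos ?_ (radical₀_pos _))
      rw [← hlcm]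
      exact CountTuple.lcm_pos hv.1
    · rintro ⟨e, he⟩
      obtain ⟨rfl, rfl⟩ := Prod.ext_iff.1 he
      have hlcm := lcm_tupleOfOrdering (r := r) e hm0
      have hk : (commutator H).index = CountTuple.lcm (tupleOfOrdering r e) *
          radical₀ (CountTuple.lcm (tupleOfOrdering r e)) * kk := by
        rw [hlcm]
        exact (Nat.mul_div_cancel' hdvd).symm
      exact ⟨isValidPair_tupleOfOrdering hr e hk, inferInstance, inferInstance, hF,
        (m_tupleOfOrdering e hm0).symm, hk, r, hr, fun i => rfl⟩
  rw [hrange, Set.ncard_image_of_injective _ hΨ, Set.ncard_univ, Nat.card_eq_fintype_card]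
  have hcard : Fintype.card (Fin s) = Fintype.card m.primeFactors := by
    rw [Fintype.card_fin, Fintype.card_coe]
    exact hb.symm
  rw [Fintype.card_equiv (Fintype.equivOfCardEq hcard), Fintype.card_fin]

end Orderings

/-! ### Double counting of classes and pairs -/

section Counting

variable {s : ℕ} {τ : Fin s → ℕ × ℕ} {k : ℕ}

theorem Realizes.card_eq {H : GrpCat.{0}} (h : Realizes H τ k) : Nat.card H =
    CountTuple.m τ * (CountTuple.lcm τ * radical₀ (CountTuple.lcm τ) * k) := by
  rw [← (commutator H).card_mul_index, h.2.2.2.1, h.2.2.2.2.1]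

/-- This gives `t² ≤ m t ≤ N`, hence the range `t ≤ √N`. It follows from `t ≤ ∏ tᵢ` and `tᵢ ≤ pᵢ -
1`. -/
theorem IsValidPair.lcm_le_m (h : IsValidPair τ k) : CountTuple.lcm τ ≤ CountTuple.m τ := by
  have h1 : CountTuple.lcm τ ≤ ∏ i, CountTuple.t τ i :=
    Nat.le_of_dvd (Finset.prod_pos fun i _ => (h.1 i).2)
      (Finset.lcm_dvd fun i _ => Finset.dvd_prod_of_mem _ (Finset.mem_univ i))
  refine h1.trans (Finset.prod_le_prod' fun i _ => ?_)
  have h2 := Nat.le_of_dvd (Nat.sub_pos_of_lt (h.p_prime i).one_lt) (h.t_dvd i)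
  have h3 : CountTuple.p τ i ≤ CountTuple.q τ i := Nat.minFac_le (h.1 i).1.pos
  omega

theorem IsValidPair.two_le_lcm (h : IsValidPair τ k) (hs : 1 ≤ s) : 2 ≤ CountTuple.lcm τ :=
  (h.2.1 ⟨0, hs⟩).1.trans_le (Nat.le_of_dvd (CountTuple.lcm_pos h.1)
    (Finset.dvd_lcm (Finset.mem_univ _)))

/-- If `pᵢ = 2`, then `tᵢ` would divide `1`. Hence the parity of the group order depends on `t` and
`k` alone. -/
theorem IsValidPair.not_two_dvd_m (h : IsValidPair τ k) : ¬ 2 ∣ CountTuple.m τ := by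
  intro h2
  have hmem : 2 ∈ (CountTuple.m τ).primeFactors := Nat.mem_primeFactors.2
    ⟨Nat.prime_two, h2, Finset.prod_ne_zero_iff.2 fun i _ => (h.1 i).1.ne_zero⟩
  rw [h.primeFactors_m] at hmem
  obtain ⟨i, -, hi⟩ := Finset.mem_image.1 hmem
  have h3 := h.t_dvd i
  rw [hi] at h3
  exact (h.2.1 i).1.ne' (Nat.dvd_one.1 h3)

theorem Realizes.odd_card_iff {H : GrpCat.{0}} (h : Realizes H τ k) (hv : IsValidPair τ k) :
    Odd (Nat.card H) ↔ ¬ 2 ∣ CountTuple.lcm τ ∧ ¬ 2 ∣ k := by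
  have h1 := hv.not_two_dvd_m
  have h2 : 2 ∣ radical₀ (CountTuple.lcm τ) → 2 ∣ CountTuple.lcm τ :=
    fun h => h.trans (radical₀_dvd _)
  rw [← Nat.not_even_iff_odd, even_iff_two_dvd, h.card_eq, Nat.prime_two.dvd_mul,
    Nat.prime_two.dvd_mul, Nat.prime_two.dvd_mul]
  tauto

theorem mem_multiplierSet_iff {N : ℕ} : k ∈ multiplierSet N τ ↔ IsValidPair τ k ∧
    CountTuple.m τ * CountTuple.lcm τ * radical₀ (CountTuple.lcm τ) * k ≤ N := by
  constructor
  · rintro ⟨hk, h0, h1, h2, h3, h4, h5⟩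
    exact ⟨⟨h0, h1, h2, hk, h4⟩, h5⟩
  · rintro ⟨⟨h0, h1, h2, hk, h4⟩, h5⟩
    exact ⟨hk, h0, h1, h2, (Nat.le_mul_of_pos_right _ hk).trans h5, h4, h5⟩

theorem realizedClasses_subset {N : ℕ} (h : k ∈ multiplierSet N τ) :
    realizedClasses τ k ⊆ complementClasses s N := by
  rintro _ ⟨H, hH, rfl⟩
  rw [mem_multiplierSet_iff] at h
  refine ⟨H, ⟨hH.1, hH.2.1, hH.2.2.1, ?_, ?_⟩, rfl⟩
  · rw [breadth, hH.2.2.2.1, h.1.card_primeFactors_m]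
  · rw [hH.card_eq, ← mul_assoc, ← mul_assoc]
    exact h.2

/-- Double counting of the pairs of a complement and a tuple that it realizes. -/
theorem factorial_mul_ncard_eq {s N : ℕ} (hs : 1 ≤ s) (T : Finset ℕ)
    (A : (Fin s → ℕ × ℕ) → Set ℕ) (hA : ∀ τ, A τ ⊆ multiplierSet N τ)
    (D : Set (Quotient groupIsoSetoid)) (hD : D ⊆ complementClasses s N)
    (h : ∀ H : GrpCat.{0}, Quotient.mk groupIsoSetoid H ∈ complementClasses s N →
      ∀ (τ : Fin s → ℕ × ℕ) (k : ℕ), k ∈ multiplierSet N τ → Realizes H τ k →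
        (Quotient.mk groupIsoSetoid H ∈ D ↔ CountTuple.lcm τ ∈ T ∧ k ∈ A τ)) :
    ((s.factorial : ℚ) * (D.ncard : ℚ)) =
      ∑ t ∈ T, ∑ τ ∈ tupleFinset s N t, ((A τ).ncard : ℚ) * CountTuple.phi τ := by
  classical
  have hDfin : D.Finite := (complementClasses_finite s N).subset hD
  have hAfin : ∀ τ, (A τ).Finite := fun τ => (multiplierSet_finite N τ).subset (hA τ)
  let S := (T.sigma (tupleFinset s N)).sigma fun x => (hAfin x.2).toFinset
  have hS : ∀ x, x ∈ S ↔ (x.1.1 ∈ T ∧ x.1.2 ∈ tupleSet s N x.1.1) ∧ x.2 ∈ A x.1.2 := by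
    intro x
    simp [S, tupleFinset]
  let R : (Σ _ : (Σ _ : ℕ, Fin s → ℕ × ℕ), ℕ) → Quotient groupIsoSetoid → Prop :=
    fun x c => c ∈ realizedClasses x.1.2 x.2
  -- By `h`, every class realizing a pair from `S` already lies in `D`, so none of the `φ(τ)`
  -- classes is lost.
  have hphi : ∀ x ∈ S, CountTuple.phi x.1.2 =
      ((Finset.bipartiteAbove R hDfin.toFinset x).card : ℚ) := by
    intro x hx
    obtain ⟨⟨hxT, hxτ⟩, hxA⟩ := (hS x).1 hx
    have hmul := hA _ hxA
    have hv := (mem_multiplierSet_iff.1 hmul).1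
    have h1 : realizedClasses x.1.2 x.2 =
        (Finset.bipartiteAbove R hDfin.toFinset x : Set (Quotient groupIsoSetoid)) := by
      ext c
      simp only [Finset.mem_coe, Finset.mem_bipartiteAbove, Set.Finite.mem_toFinset, R,
        iff_and_self]
      intro hc
      have hcc := realizedClasses_subset hmul hc
      obtain ⟨H, hH, rfl⟩ := hc
      exact (h H hcc _ _ hmul hH).2 ⟨hxτ.2.1 ▸ hxT, hxA⟩
    have h2 := hv.ncard_realizedClasses hs
    rw [h1, Set.ncard_coe_finset] at h2
    have h3 : ((CountTuple.lcm x.1.2).totient : ℚ) ≠ 0 :=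
      Nat.cast_ne_zero.2 (Nat.totient_pos.2 (CountTuple.lcm_pos hv.1)).ne'
    rw [CountTuple.phi, div_eq_iff h3]
    exact_mod_cast h2.symm
  have hfact : ∀ c ∈ hDfin.toFinset, (Finset.bipartiteBelow R S c).card = s.factorial := by
    intro c hc
    rw [Set.Finite.mem_toFinset] at hc
    obtain ⟨H, ⟨_, _, hF, hb, hN⟩, rfl⟩ := id (hD hc)
    rw [← ncard_realized_pairs hF hb, ← Set.ncard_coe_finset]
    refine Set.ncard_congr (fun x _ => (x.1.2, x.2)) ?_ ?_ ?_
    · intro x hx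
      rw [Finset.mem_coe, Finset.mem_bipartiteBelow] at hx
      exact ⟨(mem_multiplierSet_iff.1 (hA _ ((hS x).1 hx.1).2)).1,
        mk_mem_realizedClasses_iff.1 hx.2⟩
    -- The component `t` is recovered from `τ` as its least common multiple.
    · rintro ⟨⟨t, τ⟩, k⟩ ⟨⟨t', τ'⟩, k'⟩ hx hx' heq
      obtain ⟨rfl, rfl⟩ := Prod.ext_iff.1 heq
      rw [Finset.mem_coe, Finset.mem_bipartiteBelow, hS] at hx hx'
      have h1 : CountTuple.lcm τ = t := hx.1.1.2.2.1
      have h2 : CountTuple.lcm τ = t' := hx'.1.1.2.2.1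
      subst h1
      subst h2
      rfl
    · rintro ⟨τ, k⟩ ⟨hv, hR⟩
      have hcard := hR.card_eq
      have hmul : k ∈ multiplierSet N τ := by
        rw [mem_multiplierSet_iff]
        refine ⟨hv, ?_⟩
        rw [mul_assoc _ (CountTuple.lcm τ), mul_assoc, ← hcard]
        exact hN
      obtain ⟨hT, hk⟩ := (h H (hD hc) τ k hmul hR).1 hc
      refine ⟨⟨⟨CountTuple.lcm τ, τ⟩, k⟩, ?_, rfl⟩
      rw [Finset.mem_coe, Finset.mem_bipartiteBelow, hS]
      obtain ⟨-, h0, h1, h2, h3, -⟩ := hmul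
      exact ⟨⟨⟨hT, h0, rfl, h1, h2, h3⟩, hk⟩, mk_mem_realizedClasses_iff.2 hR⟩
  have hdouble := Finset.sum_card_bipartiteAbove_eq_sum_card_bipartiteBelow
    (s := S) (t := hDfin.toFinset) R
  rw [Finset.sum_congr rfl hfact, Finset.sum_const, smul_eq_mul,
    ← Set.ncard_eq_toFinset_card D hDfin] at hdouble
  calc ((s.factorial : ℚ) * (D.ncard : ℚ))
      = ∑ x ∈ S, ((Finset.bipartiteAbove R hDfin.toFinset x).card : ℚ) := by
        rw [mul_comm]; exact_mod_cast hdouble.symm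
    _ = ∑ x ∈ S, CountTuple.phi x.1.2 := Finset.sum_congr rfl fun x hx => (hphi x hx).symm
    _ = _ := by
        rw [Finset.sum_sigma, Finset.sum_sigma]
        refine Finset.sum_congr rfl fun t _ => Finset.sum_congr rfl fun τ _ => ?_
        change ∑ _ ∈ (hAfin τ).toFinset, CountTuple.phi τ = _
        rw [Finset.sum_const, nsmul_eq_mul, ← Set.ncard_eq_toFinset_card _ (hAfin τ)]

theorem lcm_mem_Icc {N : ℕ} (hs : 1 ≤ s) (h : k ∈ multiplierSet N τ) :
    CountTuple.lcm τ ∈ Finset.Icc 2 (Nat.sqrt N) := by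
  obtain ⟨hv, hN⟩ := mem_multiplierSet_iff.1 h
  rw [Finset.mem_Icc, Nat.le_sqrt]
  refine ⟨hv.two_le_lcm hs, le_trans ?_ hN⟩
  refine le_trans ?_ (Nat.le_mul_of_pos_right _ hv.2.2.2.1)
  exact (Nat.mul_le_mul_right _ hv.lcm_le_m).trans (Nat.le_mul_of_pos_right _ (radical₀_pos _))

theorem mk_mem_oddComplementClasses_iff {N : ℕ} {H : GrpCat.{0}}
    (hH : Quotient.mk groupIsoSetoid H ∈ complementClasses s N) :
    Quotient.mk groupIsoSetoid H ∈ oddComplementClasses s N ↔ Odd (Nat.card H) := by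
  constructor
  · rintro ⟨K, hK, hKH⟩
    obtain ⟨e⟩ := Quotient.exact hKH
    rw [← Nat.card_congr e.toEquiv]
    exact hK.2.2.2.2.2
  · intro hodd
    obtain ⟨K, ⟨h1, h2, h3, h4, h5⟩, hKH⟩ := hH
    obtain ⟨e⟩ := Quotient.exact hKH
    rw [← Nat.card_congr e.toEquiv] at hodd
    exact ⟨K, ⟨h1, h2, h3, h4, h5, hodd⟩, hKH⟩

end Counting

/-- Both identities are the same double count. For odd order the restriction splits into conditions
on `t` and on `k`, since `m` is always odd. -/
theorem mainTheorem6 (s N : ℕ) (hs : 1 ≤ s) :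
    ((Nat.factorial s : ℚ) * (numComplements s N : ℚ) =
      ∑ t ∈ Finset.Icc 2 (Nat.sqrt N), ∑ τ ∈ tupleFinset s N t,
        ((multiplierSet N τ).ncard : ℚ) * CountTuple.phi τ) ∧
    ((Nat.factorial s : ℚ) * (numOddComplements s N : ℚ) =
      ∑ t ∈ Finset.Icc 2 (Nat.sqrt N) with ¬ 2 ∣ t, ∑ τ ∈ tupleFinset s N t,
        ({k | k ∈ multiplierSet N τ ∧ ¬ 2 ∣ k}.ncard : ℚ) * CountTuple.phi τ) := by
  constructor
  · exact factorial_mul_ncard_eq hs _ (fun τ => multiplierSet N τ) (fun τ => subset_rfl) _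
      subset_rfl fun H hH τ k hk hR => iff_of_true hH ⟨lcm_mem_Icc hs hk, hk⟩
  · refine factorial_mul_ncard_eq hs _ (fun τ => {k | k ∈ multiplierSet N τ ∧ ¬ 2 ∣ k})
      (fun τ k hk => hk.1) (oddComplementClasses s N) ?_ ?_
    · rintro _ ⟨H, ⟨h1, h2, h3, h4, h5, -⟩, rfl⟩
      exact ⟨H, ⟨h1, h2, h3, h4, h5⟩, rfl⟩
    · intro H hH τ k hk hR
      rw [mk_mem_oddComplementClasses_iff hH, hR.odd_card_iff (mem_multiplierSet_iff.1 hk).1,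
        Finset.mem_filter]
      exact ⟨fun h => ⟨⟨lcm_mem_Icc hs hk, h.1⟩, hk, h.2⟩, fun h => ⟨h.1.2, h.2.2⟩⟩
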